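/- **Setting.** Let $\Gamma=\bigcup_{\gamma\in\mathcal E}\gamma([0,|\gamma|])\subset\mathbb R^N$ be an embedded network: $\mathcal E$ is a finite or countable collection of simple $C^1$ curves (arcs) $\gamma:[0,|\gamma|]\to\mathbb R^N$ parametrized by arc length, where $\gamma(0)=\gamma(|\gamma|)$ is allowed; $\mathcal E$ contains with each $\gamma$ the inverse arc $\widetilde\gamma(s)=\gamma(|\gamma|-s)$; $\gamma((0,|\gamma|))\cap\gamma'([0,|\gamma'|])=\emptyset$ whenever $\gamma'\neq\gamma,\widetilde\gamma$. The vertices, i.e. the points of $\mathbf V$, are the endpoints of the arcs, and $\mathcal E_x=\{\gamma\in\mathcal E:\gamma(0)=x\}$ for $x\in\mathbf V$. Assume that any two vertices are linked by a finite concatenation of arcs, that $\inf_{\gamma}|\gamma|>0$, and that every $\mathcal E_x$ is finite. $\Gamma$ carries the geodesic distance $d_\Gamma$ (infimum of the Euclidean lengths of the curves in $\Gamma$ joining two points), and $\Gamma\times[0,\infty)$ the corresponding product distance. For each $\gamma\in\mathcal E$ let $H_\gamma:[0,|\gamma|]\times[0,\infty)\times\mathbb R\to\mathbb R$, $(s,t,\mu)\mapsto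 H_\gamma(s,t,\mu)$, be continuous and convex in $\mu$, with $H_{\widetilde\gamma}(s,t,\mu)=H_\gamma(|\gamma|-s,t,-\mu)$, and assume that for every $T>0$: * there are nondecreasing, convex functions $\vartheta_T,\Theta_T:[0,\infty)\to\mathbb R$, with $\vartheta_T(r)/r\to\infty$ and $\Theta_T(r)/r\to\infty$ as $r\to\infty$, such that $\vartheta_T(|\mu|)\le H_\gamma(s,t,\mu)\le\Theta_T(|\mu|)$ for all $\gamma\in\mathcal E$, $s\in[0,|\gamma|]$, $\mu\in\mathbb R$, $t\in[0,T]$; * there are $\alpha_T,\beta_T\ge0$ and $\epsilon_T\in(0,T]$ such that $$H_\gamma(s,t_1,\mu)-H_\gamma(s,t_2,\mu)\le\Big(\alpha_T\frac{H_\gamma(s,t_2,\mu)}{1+|\mu|}+\beta_T\Big)|t_2-t_1|$$ for all $\gamma\in\mathcal E$, $s\in[0,|\gamma|]$, $\mu\in\mathbb R$ and $t_1,t_2\in[0,T]$ with $|t_2-t_1|<\epsilon_T$. Put $L_\gamma(s,\lambda,t)=\max_{\mu\in\mathbb R}\{\lambda\mu-H_\gamma(s,t,\mu)\}$. Let $(x,t)\mapsto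 c_x(t)$, from $\mathbf V\times[0,\infty)$ to $\mathbb R$, be a flux limiter: $c_x$ is continuous in $t$, $c_x(t)\le\min_{\gamma\in\mathcal E_x}L_\gamma(0,0,t)$, and for every $T>0$ there are $C_T$, $\widehat\beta_T\ge 0$ and $\widehat\epsilon_T\in(0,T]$ such that for all $x\in\mathbf V$ one has $|c_x(t)|\le C_T$ for $t\in[0,T]$, and $c_x(t_1)-c_x(t_2)\le\widehat\beta_T|t_2-t_1|$ for $t_1,t_2\in[0,T]$ with $|t_2-t_1|<\widehat\epsilon_T$. Define $$L(x,q,t)=\begin{cases}L_\gamma(s,q\cdot\dot\gamma(s),t)&\text{if }x=\gamma(s),\ s\in(0,|\gamma|),\\ \tfrac{|q|^2}{2}+c_x(t)&\text{if }x\in\mathbf V,\end{cases}$$ and let $\Phi(x_1,t_1,x_2,t_2)$ be the infimum of $\int_{t_1}^{t_2}L(\xi,\dot\xi,\tau)\,d\tau$ over the absolutely continuous curves $\xi:[t_1,t_2]\to\Gamma$ with $\xi(t_1)=x_1$, $\xi(t_2)=x_2$ (so $\Phi=+\infty$ if $t_1=t_2$ and $x_1\ne x_2$). Given $u_0:\Gamma\to\mathbb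 R$, the Lax–Oleinik value function is $$u(x,t)=\inf_{x_0\in\Gamma}\{u_0(x_0)+\Phi(x_0,0,x,t)\},\qquad (x,t)\in\Gamma\times[0,\infty).$$ **Statement.** If $u_0$ is uniformly continuous, then $u$ is real-valued on $\Gamma\times[0,\infty)$; $u$ is uniformly continuous on $\Gamma\times[0,T]$ for every $T>0$; in particular $u$ is continuous on $\Gamma\times[0,\infty)$. Moreover, $u$ is Lipschitz continuous on $\Gamma\times[\bar t,T]$ for all $T>\bar t>0$. -/

import Mathlib

open Set MeasureTheory
open scoped ENNReal NNReal

noncomputable section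

/-- An embedded network in `ℝ^N` whose oriented arcs are indexed by `E`. The curve of the arc `e` is
`curve e` restricted to `[0, len e]`; its values elsewhere are irrelevant. -/
structure EmbeddedNetwork (N : ℕ) (E : Type*) where
  /-- arc length parametrization of each arc -/
  curve : E → ℝ → EuclideanSpace ℝ (Fin N)
  /-- Euclidean length of each arc -/
  len : E → ℝ
  /-- the inverse arc -/
  rev : E → E
  len_bound : ∃ m : ℝ, 0 < m ∧ ∀ e, m ≤ len e
  contDiffOn : ∀ e, ContDiffOn ℝ 1 (curve e) (Icc 0 (len e))
  unit_speed : ∀ e, ∀ s ∈ Icc 0 (len e), ‖derivWithin (curve e) (Icc 0 (len e)) s‖ = 1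
  /-- the arcs are simple curves; only the two endpoints may coincide (loops are admitted) -/
  injOn_Ico : ∀ e, InjOn (curve e) (Ico 0 (len e))
  injOn_Ioc : ∀ e, InjOn (curve e) (Ioc 0 (len e))
  len_rev : ∀ e, len (rev e) = len e
  curve_rev : ∀ e, ∀ s ∈ Icc 0 (len e), curve (rev e) s = curve e (len e - s)
  no_overlap : ∀ e e', e' ≠ e → e' ≠ rev e →
    Disjoint (curve e '' Ioo 0 (len e)) (curve e' '' Icc 0 (len e'))
  /-- any two vertices are linked by a finite concatenation of arcs -/
  connected : ∀ e e', Relation.ReflTransGen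
    (fun x y => ∃ a, curve a 0 = x ∧ curve a (len a) = y) (curve e 0) (curve e' 0)
  locally_finite : ∀ x, {e | curve e 0 = x}.Finite

namespace EmbeddedNetwork

variable {N : ℕ} {E : Type*} (G : EmbeddedNetwork N E)

/-- The subset `Γ` of `ℝ^N`. -/
def carrier : Set (EuclideanSpace ℝ (Fin N)) :=
  ⋃ e, G.curve e '' Icc 0 (G.len e)

/-- The initial and terminal points of the arcs. -/
def vertices : Set (EuclideanSpace ℝ (Fin N)) :=
  {x | ∃ e, x = G.curve e 0 ∨ x = G.curve e (G.len e)}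

/-- The unit tangent vector of an arc (one-sided at the endpoints). -/
def tangent (e : E) (s : ℝ) : EuclideanSpace ℝ (Fin N) :=
  derivWithin (G.curve e) (Icc 0 (G.len e)) s

/-- The geodesic distance: infimum of the Euclidean lengths of the curves in `Γ` from `x` to `y`. -/
def geodesicEDist (x y : EuclideanSpace ℝ (Fin N)) : ℝ≥0∞ :=
  ⨅ (ξ : ℝ → EuclideanSpace ℝ (Fin N)) (_ : ContinuousOn ξ (Icc 0 1) ∧
    MapsTo ξ (Icc 0 1) G.carrier ∧ ξ 0 = x ∧ ξ 1 = y), eVariationOn ξ (Icc 0 1)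

/-- The points of the network, as a type that carries the geodesic distance (and not the distance
induced by `ℝ^N`). -/
def Pt : Type := {x : EuclideanSpace ℝ (Fin N) // x ∈ G.carrier}

theorem geodesicEDist_self {x : EuclideanSpace ℝ (Fin N)} (hx : x ∈ G.carrier) :
    G.geodesicEDist x x = 0 := by
  refine le_antisymm ?_ bot_le
  refine (iInf₂_le (fun _ => x) ⟨continuousOn_const, fun _ _ => hx, rfl, rfl⟩).trans ?_
  exact (eVariationOn.constant_on (by
    rintro _ ⟨_, _, rfl⟩ _ ⟨_, _, rfl⟩; rfl)).le

theorem geodesicEDist_le_comm (x y : EuclideanSpace ℝ (Fin N)) :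
    G.geodesicEDist x y ≤ G.geodesicEDist y x := by
  refine le_iInf₂ fun ξ h => ?_
  obtain ⟨hc, hm, h0, h1⟩ := h
  have hmaps : MapsTo (fun s : ℝ => 1 - s) (Icc 0 1) (Icc 0 1) := by
    intro s hs
    simp only [mem_Icc] at hs ⊢
    constructor <;> linarith [hs.1, hs.2]
  refine (iInf₂_le (ξ ∘ fun s : ℝ => 1 - s)
    ⟨hc.comp (by fun_prop) hmaps, hm.comp hmaps, by simp [h1], by simp [h0]⟩).trans ?_
  exact eVariationOn.comp_le_of_antitoneOn ξ _ (fun a _ b _ hab => sub_le_sub_left hab 1) hmaps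

theorem geodesicEDist_triangle (x y z : EuclideanSpace ℝ (Fin N)) :
    G.geodesicEDist x z ≤ G.geodesicEDist x y + G.geodesicEDist y z := by
  unfold geodesicEDist
  refine ENNReal.le_of_forall_pos_le_add fun ε hε hlt => ?_
  have hε2 : (ε / 2 : ℝ≥0∞) ≠ 0 := by simpa using hε.ne'
  obtain ⟨hx, hy⟩ := ENNReal.add_lt_top.1 hlt
  have h1 := ENNReal.lt_add_right hx.ne hε2
  have h2 := ENNReal.lt_add_right hy.ne hε2
  obtain ⟨ξ, h1⟩ := iInf_lt_iff.1 h1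
  obtain ⟨⟨hξc, hξm, hξ0, hξ1⟩, h1⟩ := iInf_lt_iff.1 h1
  obtain ⟨η, h2⟩ := iInf_lt_iff.1 h2
  obtain ⟨⟨hηc, hηm, hη0, hη1⟩, h2⟩ := iInf_lt_iff.1 h2
  set ζ : ℝ → EuclideanSpace ℝ (Fin N) :=
    fun s => if s ≤ 1 / 2 then ξ (2 * s) else η (2 * s - 1) with hζ
  have ea : EqOn ζ (ξ ∘ fun s => 2 * s) (Icc 0 (1 / 2)) := fun s hs => by
    simp [hζ, hs.2.trans_eq (one_div 2)]
  have eb : EqOn ζ (η ∘ fun s => 2 * s - 1) (Icc (1 / 2) 1) := fun s hs => by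
    rcases hs.1.eq_or_lt with h | h
    · subst h; simp [hζ, hξ1, hη0]
    · simp only [hζ, Function.comp, if_neg (not_le.2 h)]
  have ma : MapsTo (fun s : ℝ => 2 * s) (Icc 0 (1 / 2)) (Icc 0 1) := fun s hs => by
    simp only [mem_Icc] at hs ⊢
    constructor <;> linarith [hs.1, hs.2]
  have mb : MapsTo (fun s : ℝ => 2 * s - 1) (Icc (1 / 2) 1) (Icc 0 1) := fun s hs => by
    simp only [mem_Icc] at hs ⊢
    constructor <;> linarith [hs.1, hs.2]
  have hU : Icc (0 : ℝ) 1 = Icc 0 (1 / 2) ∪ Icc (1 / 2) 1 :=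
    (Icc_union_Icc_eq_Icc (by norm_num) (by norm_num)).symm
  have hζc : ContinuousOn ζ (Icc 0 1) := by
    rw [hU]
    exact ((hξc.comp (by fun_prop) ma).congr ea).union_of_isClosed
      ((hηc.comp (by fun_prop) mb).congr eb) isClosed_Icc isClosed_Icc
  have hζm : MapsTo ζ (Icc 0 1) G.carrier := by
    rw [hU]
    exact ((hξm.comp ma).congr ea.symm).union ((hηm.comp mb).congr eb.symm)
  have hvar : eVariationOn ζ (Icc 0 1) ≤
      eVariationOn ξ (Icc 0 1) + eVariationOn η (Icc 0 1) := by
    have hsum : eVariationOn ζ (Icc 0 1) =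
        eVariationOn (ξ ∘ fun s => 2 * s) (Icc 0 (1 / 2)) +
          eVariationOn (η ∘ fun s => 2 * s - 1) (Icc (1 / 2) 1) := by
      rw [hU, eVariationOn.union ζ (isGreatest_Icc (by norm_num)) (isLeast_Icc (by norm_num)),
        eVariationOn.eq_of_eqOn ea, eVariationOn.eq_of_eqOn eb]
    rw [hsum]
    exact add_le_add
      (eVariationOn.comp_le_of_monotoneOn ξ _ (fun a _ b _ hab => by simpa using hab) ma)
      (eVariationOn.comp_le_of_monotoneOn η _ (fun a _ b _ hab => by simpa using hab) mb)
  have hζ1 : ζ 1 = z := by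
    have h : ¬ (1 : ℝ) ≤ 1 / 2 := by norm_num
    simp only [hζ, if_neg h]
    norm_num [hη1]
  refine (iInf₂_le ζ ⟨hζc, hζm, by simp [hζ, hξ0], hζ1⟩).trans (hvar.trans ?_)
  refine (add_le_add h1.le h2.le).trans (le_of_eq ?_)
  rw [add_add_add_comm, ENNReal.add_halves]

instance : PseudoEMetricSpace G.Pt where
  edist x y := G.geodesicEDist x.1 y.1
  edist_self x := G.geodesicEDist_self x.2
  edist_comm x y := le_antisymm (G.geodesicEDist_le_comm _ _) (G.geodesicEDist_le_comm _ _)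
  edist_triangle x y z := G.geodesicEDist_triangle _ _ _

/-- `f : [0, ∞) → ℝ` is nondecreasing, convex and superlinearly coercive. -/
def IsSuperlinearBound (f : ℝ → ℝ) : Prop :=
  MonotoneOn f (Ici 0) ∧ ConvexOn ℝ (Ici 0) f ∧
    Filter.Tendsto (fun r => f r / r) Filter.atTop Filter.atTop

/-- A Hamiltonian on the network: `H e s t μ` is the value of the Hamiltonian of the arc `e` at the
state `s ∈ [0, len e]`, the time `t ≥ 0` and the momentum `μ`. -/
structure IsHamiltonian (H : E → ℝ → ℝ → ℝ → ℝ) : Prop where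
  compat : ∀ e, ∀ s ∈ Icc 0 (G.len e), ∀ t, 0 ≤ t → ∀ μ,
    H (G.rev e) s t μ = H e (G.len e - s) t (-μ)
  continuousOn : ∀ e, ContinuousOn (fun p : ℝ × ℝ × ℝ => H e p.1 p.2.1 p.2.2)
    (Icc 0 (G.len e) ×ˢ Ici 0 ×ˢ univ)
  convex : ∀ e, ∀ s ∈ Icc 0 (G.len e), ∀ t, 0 ≤ t → ConvexOn ℝ univ (H e s t)
  coercive : ∀ T, 0 < T → ∃ θ Θ : ℝ → ℝ, IsSuperlinearBound θ ∧ IsSuperlinearBound Θ ∧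
    ∀ e, ∀ s ∈ Icc 0 (G.len e), ∀ μ, ∀ t ∈ Icc 0 T, θ |μ| ≤ H e s t μ ∧ H e s t μ ≤ Θ |μ|
  time_lipschitz : ∀ T, 0 < T → ∃ α β ε : ℝ, 0 ≤ α ∧ 0 ≤ β ∧ ε ∈ Ioc 0 T ∧
    ∀ e, ∀ s ∈ Icc 0 (G.len e), ∀ μ, ∀ t₁ ∈ Icc 0 T, ∀ t₂ ∈ Icc 0 T, |t₂ - t₁| < ε →
      H e s t₁ μ - H e s t₂ μ ≤ (α * (H e s t₂ μ / (1 + |μ|)) + β) * |t₂ - t₁|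

/-- The Lagrangian of the arc `e`, the convex conjugate of `H e s t`. -/
def arcLagrangian (H : E → ℝ → ℝ → ℝ → ℝ) (e : E) (s l t : ℝ) : ℝ :=
  ⨆ μ : ℝ, (l * μ - H e s t μ)

/-- `c x t` is a flux limiter (only its values at vertices `x` and times `t ≥ 0` matter) that is
locally bounded and locally Lipschitz continuous in time, uniformly with respect to the vertex. -/
structure IsFluxLimiter (H : E → ℝ → ℝ → ℝ → ℝ)
    (c : EuclideanSpace ℝ (Fin N) → ℝ → ℝ) : Prop where
  continuousOn : ∀ x ∈ G.vertices, ContinuousOn (c x) (Ici 0)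
  /-- `c x t` is at most the minimum of `L_e(0, 0, t)` over the arcs `e` with initial point `x` -/
  le_max : ∀ x ∈ G.vertices, ∀ t, 0 ≤ t → ∀ e, G.curve e 0 = x → c x t ≤ arcLagrangian H e 0 0 t
  bound : ∀ T, 0 < T → ∃ C : ℝ, ∀ x ∈ G.vertices, ∀ t ∈ Icc 0 T, |c x t| ≤ C
  time_lipschitz : ∀ T, 0 < T → ∃ β ε : ℝ, 0 ≤ β ∧ ε ∈ Ioc 0 T ∧
    ∀ x ∈ G.vertices, ∀ t₁ ∈ Icc 0 T, ∀ t₂ ∈ Icc 0 T, |t₂ - t₁| < ε →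
      c x t₁ - c x t₂ ≤ β * |t₂ - t₁|

open Classical in
/-- The overall Lagrangian. Outside the vertices one chooses an arc `e` and an `s ∈ (0, len e)` with
`x = curve e s`; for tangent `q` the result does not depend on the choice, by the compatibility of
`H` with inversion of arcs. The value for `x ∉ Γ` is irrelevant. -/
def lagrangian (H : E → ℝ → ℝ → ℝ → ℝ) (c : EuclideanSpace ℝ (Fin N) → ℝ → ℝ)
    (x q : EuclideanSpace ℝ (Fin N)) (t : ℝ) : ℝ :=
  if x ∈ G.vertices then ‖q‖ ^ 2 / 2 + c x t
  else if h : ∃ p : E × ℝ, p.2 ∈ Ioo 0 (G.len p.1) ∧ G.curve p.1 p.2 = x then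
    arcLagrangian H h.choose.1 h.choose.2
      (inner ℝ q (G.tangent h.choose.1 h.choose.2)) t
  else 0

/-- The action of a curve on `[t₁, t₂]`: the integral of the Lagrangian as an extended real number,
integral of the positive part minus integral of the negative part. -/
def action (H : E → ℝ → ℝ → ℝ → ℝ) (c : EuclideanSpace ℝ (Fin N) → ℝ → ℝ)
    (t₁ t₂ : ℝ) (ξ : ℝ → EuclideanSpace ℝ (Fin N)) : EReal :=
  ((∫⁻ τ in Icc t₁ t₂, ENNReal.ofReal (G.lagrangian H c (ξ τ) (deriv ξ τ) τ) : ℝ≥0∞) : EReal) -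
    ((∫⁻ τ in Icc t₁ t₂, ENNReal.ofReal (-G.lagrangian H c (ξ τ) (deriv ξ τ) τ) : ℝ≥0∞) : EReal)

/-- The minimal action functional: infimum of the action over the absolutely continuous curves in
`Γ` with the given endpoints. It is `⊤` if `t₁ = t₂` and `x₁ ≠ x₂`, since then there is no curve. -/
def minAction (H : E → ℝ → ℝ → ℝ → ℝ) (c : EuclideanSpace ℝ (Fin N) → ℝ → ℝ)
    (x₁ : G.Pt) (t₁ : ℝ) (x₂ : G.Pt) (t₂ : ℝ) : EReal :=
  ⨅ (ξ : ℝ → EuclideanSpace ℝ (Fin N)) (_ : AbsolutelyContinuousOnInterval ξ t₁ t₂ ∧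
    MapsTo ξ (Icc t₁ t₂) G.carrier ∧ ξ t₁ = x₁.1 ∧ ξ t₂ = x₂.1), G.action H c t₁ t₂ ξ

/-- The Lax–Oleinik value function. -/
def valueFunction (H : E → ℝ → ℝ → ℝ → ℝ) (c : EuclideanSpace ℝ (Fin N) → ℝ → ℝ)
    (u₀ : G.Pt → ℝ) (x : G.Pt) (t : ℝ) : EReal :=
  ⨅ x₀ : G.Pt, ((u₀ x₀ : EReal) + G.minAction H c x₀ 0 x t)

end EmbeddedNetwork

end

/-! Everything rests on comparing curves of finite action; neither minimizers nor their Lipschitz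
regularity are needed. Write `u(x,t)` for the infimum of the real set `costs`. It equals the value
function, because the Lagrangian along an admissible curve is measurable and bounded below, so an
action is either an integral or `⊤` (`valueFunction_eq_sInf`).

Three estimates, uniform on the network, carry the proof. (1) Coercivity
(`exists_cost_lower_bound`). The datum satisfies `|u₀ x - u₀ y| ≤ ε + A d(x,y)`, since a uniformly
continuous function on a length space grows at most linearly, while `L ≥ (A+1)|q| - M` along almost
every velocity of a curve. Hence cost `≥ u₀(x) - ε - M t + length`. This bounds `u` from below,
controls it as `t → 0`, and bounds the length of almost optimal curves. (2) Concatenation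
(`exists_cost_concat`). Walking from `x` to `y` at speed at most 1 gives `u(y,t+h) ≤ u(x,t) + B h`
when `d(x,y) < h`. In particular `u(x,t) ≤ u₀(x) + B t`. (3) Acceleration (`exists_cost_speed_up`).
For `t ≥ t₀ > 0`, an almost optimal curve can arrive earlier: `u(x,t-δ) ≤ u(x,t) + C δ` for small
`δ`. Its length is bounded, so its speed is bounded on a set of times of measure at least `t/2`.
Only there is it accelerated, at a cost controlled by the conjugate structure of `L`. The time shift
costs at most a multiple of `δ ∫ (1 + |ξ'|)`, which the length bound controls even where the speed
is unbounded.

Accelerating by `δ` and spending the gained time on a walk gives Lipschitz continuity in space.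
Waiting and accelerating give it in time. Near `t = 0`, uniform continuity is inherited from `u₀`
through (1) and (2). -/

section

open Filter Topology

/-! ### Absolutely continuous curves: domination and composition. -/

section AbsolutelyContinuous

variable {X : Type*} [PseudoMetricSpace X] {f : ℝ → X} {a b : ℝ}

/-- A curve whose increments are dominated by the integrals of an integrable function is absolutely
continuous. -/
theorem AbsolutelyContinuousOnInterval.of_dist_le {g : ℝ → ℝ} (hab : a ≤ b)
    (hg : IntervalIntegrable g volume a b)
    (h : ∀ x ∈ Icc a b, ∀ y ∈ Icc a b, x ≤ y → dist (f x) (f y) ≤ ∫ τ in x..y, g τ) :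
    AbsolutelyContinuousOnInterval f a b := by
  have hG := hg.absolutelyContinuousOnInterval_intervalIntegral left_mem_uIcc
  have key : ∀ x ∈ Icc a b, ∀ y ∈ Icc a b, x ≤ y →
      dist (f x) (f y) ≤ dist (∫ τ in a..x, g τ) (∫ τ in a..y, g τ) := by
    intro x hx y hy hxy
    refine (h x hx y hy hxy).trans ?_
    have hi : ∀ z ∈ Icc a b, IntervalIntegrable g volume a z := fun z hz =>
      hg.mono_set (by rw [uIcc_of_le hz.1, uIcc_of_le hab]; exact Icc_subset_Icc_right hz.2)
    rw [dist_comm, Real.dist_eq, intervalIntegral.integral_interval_sub_left (hi y hy) (hi x hx)]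
    exact le_abs_self _
  have key' : ∀ x ∈ Icc a b, ∀ y ∈ Icc a b,
      dist (f x) (f y) ≤ dist (∫ τ in a..x, g τ) (∫ τ in a..y, g τ) := by
    intro x hx y hy
    rcases le_total x y with hxy | hxy
    · exact key x hx y hy hxy
    · rw [dist_comm, dist_comm (∫ τ in a..x, g τ)]
      exact key y hy x hx hxy
  rw [absolutelyContinuousOnInterval_iff] at hG ⊢
  intro ε hε
  obtain ⟨δ, hδ, H⟩ := hG ε hε
  refine ⟨δ, hδ, fun I hI hI' => lt_of_le_of_lt (Finset.sum_le_sum fun i hi => ?_) (H I hI hI')⟩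
  have := hI.1 i hi
  rw [uIcc_of_le hab] at this
  exact key' _ this.1 _ this.2

theorem AbsolutelyContinuousOnInterval.comp_left {Y : Type*} [PseudoMetricSpace Y] {φ : X → Y}
    {K : ℝ≥0} (hφ : LipschitzWith K φ) (hf : AbsolutelyContinuousOnInterval f a b) :
    AbsolutelyContinuousOnInterval (fun τ => φ (f τ)) a b := by
  refine squeeze_zero (fun _ => Finset.sum_nonneg fun _ _ => dist_nonneg) (fun I => ?_)
    (by simpa using Tendsto.const_mul (K : ℝ) hf)
  rw [Finset.mul_sum]
  exact Finset.sum_le_sum fun i _ => hφ.dist_le_mul _ _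

/-- A monotone Lipschitz map sends disjoint half-open intervals to disjoint ones and multiplies
their total length by at most `K`. -/
theorem AbsolutelyContinuousOnInterval.comp_right {φ : ℝ → ℝ} {K : ℝ≥0} {a' b' : ℝ}
    (hf : AbsolutelyContinuousOnInterval f a b) (hφ : LipschitzWith K φ) (hm : Monotone φ)
    (hmaps : MapsTo φ (uIcc a' b') (uIcc a b)) :
    AbsolutelyContinuousOnInterval (f ∘ φ) a' b' := by
  rw [absolutelyContinuousOnInterval_iff] at hf ⊢
  intro ε hε
  obtain ⟨δ, hδ, H⟩ := hf ε hε
  -- Dividing by `K + 1` also covers `K = 0`.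
  refine ⟨δ / (K + 1), by positivity, fun I hI hI' => ?_⟩
  refine H (I.1, fun i => (φ (I.2 i).1, φ (I.2 i).2))
    ⟨fun i hi => ⟨hmaps (hI.1 i hi).1, hmaps (hI.1 i hi).2⟩, ?_⟩ ?_
  · intro i hi j hj hij
    have := hI.2 hi hj hij
    simp only [Function.onFun, disjoint_left, mem_uIoc] at this ⊢
    intro z hz hz'
    -- A common point `z` of two image intervals forces the original ones to overlap, with `min q s`
    -- as a common point.
    have aux : ∀ p q r s : ℝ, φ p < z → z ≤ φ q → φ r < z → z ≤ φ s →
        max p r < min q s := by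
      intro p q r s h1 h2 h3 h4
      have e := fun {u v : ℝ} (hu : φ u < z) (hv : z ≤ φ v) => hm.reflect_lt (hu.trans_le hv)
      exact max_lt (lt_min (e h1 h2) (e h1 h4)) (lt_min (e h3 h2) (e h3 h4))
    have done : ∀ p q r s : ℝ, max p r < min q s →
        (p < min q s ∧ min q s ≤ q) ∧ (r < min q s ∧ min q s ≤ s) := fun p q r s h =>
      ⟨⟨(le_max_left _ _).trans_lt h, min_le_left _ _⟩,
        ⟨(le_max_right _ _).trans_lt h, min_le_right _ _⟩⟩
    rcases hz with ⟨h1, h2⟩ | ⟨h1, h2⟩ <;> rcases hz' with ⟨h3, h4⟩ | ⟨h3, h4⟩ <;>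
    · obtain ⟨A, B⟩ := done _ _ _ _ (aux _ _ _ _ h1 h2 h3 h4)
      exact this (by tauto) (by tauto)
  · calc ∑ i ∈ Finset.range I.1, dist (φ (I.2 i).1) (φ (I.2 i).2)
        ≤ ∑ i ∈ Finset.range I.1, (K : ℝ) * dist (I.2 i).1 (I.2 i).2 :=
          Finset.sum_le_sum fun i _ => hφ.dist_le_mul _ _
      _ = K * ∑ i ∈ Finset.range I.1, dist (I.2 i).1 (I.2 i).2 := by rw [Finset.mul_sum]
      _ ≤ (K + 1) * ∑ i ∈ Finset.range I.1, dist (I.2 i).1 (I.2 i).2 := by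
          gcongr
          simp
      _ < (K + 1) * (δ / (K + 1)) := by gcongr
      _ = δ := by field_simp

end AbsolutelyContinuous

/-! ### Length of absolutely continuous curves in Euclidean space. -/

section Euclidean

variable {N : ℕ} {ξ : ℝ → EuclideanSpace ℝ (Fin N)} {a b : ℝ}

theorem AbsolutelyContinuousOnInterval.ae_differentiableAt_euclidean
    (h : AbsolutelyContinuousOnInterval ξ a b) :
    ∀ᵐ τ, τ ∈ uIcc a b → DifferentiableAt ℝ ξ τ :=
  h.boundedVariationOn.ae_differentiableAt_of_mem_uIcc

theorem hasDerivAt_inner_left {v q : EuclideanSpace ℝ (Fin N)} {τ : ℝ} (h : HasDerivAt ξ q τ) :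
    HasDerivAt (fun τ => inner ℝ v (ξ τ)) (inner ℝ v q) τ :=
  ((innerSL ℝ v).hasFDerivAt.comp_hasDerivAt τ h)

theorem AbsolutelyContinuousOnInterval.inner_left (h : AbsolutelyContinuousOnInterval ξ a b)
    (v : EuclideanSpace ℝ (Fin N)) :
    AbsolutelyContinuousOnInterval (fun τ => inner ℝ v (ξ τ)) a b :=
  h.comp_left (φ := fun x => inner ℝ v x) (innerSL ℝ v).lipschitz

/-- The Euclidean norm is at most the sum of the absolute values of the coordinates, whose
derivatives are integrable by the scalar theory. -/
theorem AbsolutelyContinuousOnInterval.intervalIntegrable_norm_deriv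
    (h : AbsolutelyContinuousOnInterval ξ a b) :
    IntervalIntegrable (fun τ => ‖deriv ξ τ‖) volume a b := by
  have hsum : IntervalIntegrable
      (fun τ => ∑ i, |deriv (fun τ => inner ℝ (EuclideanSpace.single i (1 : ℝ)) (ξ τ)) τ|)
      volume a b := by
    have := IntervalIntegrable.sum (μ := volume) (a := a) (b := b) Finset.univ
      (f := fun (i : Fin N) τ =>
        |deriv (fun τ => inner ℝ (EuclideanSpace.single i (1 : ℝ)) (ξ τ)) τ|)
      (fun i _ => (h.inner_left _).intervalIntegrable_deriv.abs)
    simpa only [Finset.sum_fn] using this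
  refine hsum.mono_fun (measurable_deriv ξ).norm.aestronglyMeasurable ?_
  filter_upwards [ae_restrict_of_ae h.ae_differentiableAt_euclidean,
    ae_restrict_mem measurableSet_uIoc] with τ hτ hm
  have hd := hτ (uIoc_subset_uIcc hm)
  have e : ∀ i, deriv (fun τ => inner ℝ (EuclideanSpace.single i (1 : ℝ)) (ξ τ)) τ
      = deriv ξ τ i := fun i => by
    rw [(hasDerivAt_inner_left hd.hasDerivAt).deriv]
    simp [EuclideanSpace.inner_single_left]
  simp only [e, norm_norm]
  refine le_trans ?_ (le_abs_self _)
  rw [EuclideanSpace.norm_eq]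
  refine Real.sqrt_le_iff.2 ⟨Finset.sum_nonneg fun _ _ => abs_nonneg _, ?_⟩
  exact Finset.sum_sq_le_sq_sum_of_nonneg (s := Finset.univ) fun i _ => norm_nonneg (deriv ξ τ i)

/-- The scalar fundamental theorem is applied to the component of `ξ` along `ξ b - ξ a`;
Cauchy–Schwarz then leaves one factor `‖ξ b - ξ a‖` to cancel. -/
theorem AbsolutelyContinuousOnInterval.norm_sub_le_integral (hab : a ≤ b)
    (h : AbsolutelyContinuousOnInterval ξ a b) :
    ‖ξ b - ξ a‖ ≤ ∫ τ in a..b, ‖deriv ξ τ‖ := by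
  rcases eq_or_ne (ξ b - ξ a) 0 with h0 | h0
  · rw [h0, norm_zero]
    exact intervalIntegral.integral_nonneg hab fun _ _ => norm_nonneg _
  have hac := h.inner_left (ξ b - ξ a)
  have hle : ∫ τ in a..b, deriv (fun τ => inner ℝ (ξ b - ξ a) (ξ τ)) τ ≤
      ∫ τ in a..b, ‖ξ b - ξ a‖ * ‖deriv ξ τ‖ := by
    refine intervalIntegral.integral_mono_ae_restrict hab hac.intervalIntegrable_deriv
      (h.intervalIntegrable_norm_deriv.const_mul _) ?_
    filter_upwards [ae_restrict_of_ae h.ae_differentiableAt_euclidean,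
      ae_restrict_mem measurableSet_Icc] with τ hτ hm
    rw [uIcc_of_le hab] at hτ
    rw [(hasDerivAt_inner_left (hτ hm).hasDerivAt).deriv]
    exact real_inner_le_norm _ _
  rw [hac.integral_deriv_eq_sub, ← inner_sub_right, real_inner_self_eq_norm_sq,
    intervalIntegral.integral_const_mul, sq] at hle
  exact le_of_mul_le_mul_left hle (norm_pos_iff.2 h0)

theorem AbsolutelyContinuousOnInterval.eVariationOn_le (hab : a ≤ b)
    (h : AbsolutelyContinuousOnInterval ξ a b) :
    eVariationOn ξ (Icc a b) ≤ ENNReal.ofReal (∫ τ in a..b, ‖deriv ξ τ‖) := by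
  have hi := h.intervalIntegrable_norm_deriv
  have sub : ∀ x ∈ Icc a b, ∀ y ∈ Icc a b, uIcc x y ⊆ uIcc a b := fun x hx y hy =>
    uIcc_subset_uIcc (by rwa [uIcc_of_le hab]) (by rwa [uIcc_of_le hab])
  refine iSup_le fun ⟨n, u, hu, hus⟩ => ?_
  have h1 : ∀ i, edist (ξ (u (i + 1))) (ξ (u i)) ≤
      ENNReal.ofReal (∫ τ in u i..u (i + 1), ‖deriv ξ τ‖) := fun i => by
    rw [edist_dist, dist_eq_norm]
    exact ENNReal.ofReal_le_ofReal
      ((h.mono (sub _ (hus i) _ (hus (i + 1)))).norm_sub_le_integral (hu i.le_succ))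
  refine (Finset.sum_le_sum fun i _ => h1 i).trans ?_
  rw [← ENNReal.ofReal_sum_of_nonneg fun i _ =>
    intervalIntegral.integral_nonneg (hu i.le_succ) fun _ _ => norm_nonneg _,
    intervalIntegral.sum_integral_adjacent_intervals fun k _ =>
      hi.mono_set (sub _ (hus k) _ (hus (k + 1)))]
  refine ENNReal.ofReal_le_ofReal ?_
  exact intervalIntegral.integral_mono_interval (hus 0).1 (hu (Nat.zero_le n)) (hus n).2
    (ae_of_all _ fun _ => norm_nonneg _) hi

end Euclidean

/-! ### The network as a length space. -/

namespace EmbeddedNetwork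

variable {N : ℕ} {E : Type*} (G : EmbeddedNetwork N E)

theorem edist_eq_geodesicEDist (x y : G.Pt) : edist x y = G.geodesicEDist x.1 y.1 := rfl

/-- A point of the carrier as a point of the network. -/
def mkPt (x : EuclideanSpace ℝ (Fin N)) (hx : x ∈ G.carrier) : G.Pt := ⟨x, hx⟩

theorem mkPt_eq {x : EuclideanSpace ℝ (Fin N)} {hx : x ∈ G.carrier} {y : G.Pt} (h : x = y.1) :
    G.mkPt x hx = y := Subtype.ext h

theorem geodesicEDist_le_eVariationOn {ξ : ℝ → EuclideanSpace ℝ (Fin N)} {a b : ℝ} (hab : a ≤ b)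
    (hc : ContinuousOn ξ (Icc a b)) (hm : MapsTo ξ (Icc a b) G.carrier) :
    G.geodesicEDist (ξ a) (ξ b) ≤ eVariationOn ξ (Icc a b) := by
  have hmaps : MapsTo (fun s : ℝ => a + s * (b - a)) (Icc 0 1) (Icc a b) := fun s hs => by
    have h0 : 0 ≤ s * (b - a) := mul_nonneg hs.1 (sub_nonneg.2 hab)
    have h1 : s * (b - a) ≤ 1 * (b - a) := mul_le_mul_of_nonneg_right hs.2 (sub_nonneg.2 hab)
    constructor <;> linarith
  refine (iInf₂_le (ξ ∘ fun s : ℝ => a + s * (b - a))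
    ⟨hc.comp (by fun_prop) hmaps, hm.comp hmaps, by simp, by simp⟩).trans ?_
  refine eVariationOn.comp_le_of_monotoneOn ξ _ (fun s _ s' _ h => ?_) hmaps
  have := mul_le_mul_of_nonneg_right h (sub_nonneg.2 hab)
  simpa using this

/-- Two points whose geodesic distance is less than `D` are joined by a `D`-Lipschitz path. -/
theorem exists_lipschitz_path {x y : G.Pt} {D : ℝ} (h : edist x y < ENNReal.ofReal D) :
    ∃ ζ : ℝ → EuclideanSpace ℝ (Fin N), LipschitzOnWith D.toNNReal ζ (Icc 0 1) ∧
      MapsTo ζ (Icc 0 1) G.carrier ∧ ζ 0 = x.1 ∧ ζ 1 = y.1 := by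
  rw [edist_eq_geodesicEDist] at h
  obtain ⟨f, h⟩ := iInf_lt_iff.1 h
  obtain ⟨⟨hc, hm, h0, h1⟩, h⟩ := iInf_lt_iff.1 h
  have m0 : (0 : ℝ) ∈ Icc (0 : ℝ) 1 := by simp
  have m1 : (1 : ℝ) ∈ Icc (0 : ℝ) 1 := by simp
  have hbv : LocallyBoundedVariationOn f (Icc 0 1) :=
    BoundedVariationOn.locallyBoundedVariationOn (ne_top_of_lt h)
  -- The path sought is the arc length reparametrization of `f`, run at constant speed `v 1 < D`. It
  -- is meaningful on all of `[0, v 1]` because `v` is continuous and so misses no value.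
  set v := variationOnFromTo f (Icc 0 1) 0 with hv
  have v0 : v 0 = 0 := variationOnFromTo.self _ _ _
  have v1 : ENNReal.ofReal (v 1) = eVariationOn f (Icc 0 1) := by
    rw [hv, variationOnFromTo.eq_of_le _ _ zero_le_one, inter_self,
      ENNReal.ofReal_toReal (ne_top_of_lt h)]
  have v1nn : 0 ≤ v 1 := variationOnFromTo.nonneg_of_le _ _ zero_le_one
  have vD : v 1 < D := by
    rw [← v1] at h
    exact (ENNReal.ofReal_lt_ofReal_iff_of_nonneg v1nn).1 h
  have hcont : ContinuousOn v (Icc 0 1) := by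
    intro s hs
    have hl : ContinuousWithinAt v (Icc 0 1 ∩ Iio s) s := by
      have := variationOnFromTo.tendsto_left (a := 0) m0 hs hbv
        ((hc s hs).mono_left (nhdsWithin_mono _ inter_subset_left))
      simpa [ContinuousWithinAt] using this
    have hr : ContinuousWithinAt v (Icc 0 1 ∩ Ioi s) s := by
      have := variationOnFromTo.tendsto_right (a := 0) m0 hs hbv
        ((hc s hs).mono_left (nhdsWithin_mono _ inter_subset_left))
      simpa [ContinuousWithinAt] using this
    have h := (hl.union hr).union (continuousWithinAt_singleton (f := v) (x := s))
    refine h.mono fun z hz => ?_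
    rcases lt_trichotomy z s with hzs | hzs | hzs
    · exact Or.inl (Or.inl ⟨hz, hzs⟩)
    · exact Or.inr hzs
    · exact Or.inl (Or.inr ⟨hz, hzs⟩)
  have himg : Icc 0 (v 1) ⊆ v '' Icc 0 1 := by
    have := intermediate_value_Icc zero_le_one hcont
    rwa [v0] at this
  have hunit := has_unit_speed_naturalParameterization f hbv m0
  have hpar : ∀ s ∈ Icc (0 : ℝ) 1, naturalParameterization f (Icc 0 1) 0 (v s) = f s := fun s hs =>
    edist_eq_zero.1 (edist_naturalParameterization_eq_zero hbv m0 hs)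
  have hmaps : MapsTo (fun s => v 1 * s) (Icc 0 1) (v '' Icc 0 1) := fun s hs =>
    himg ⟨mul_nonneg v1nn hs.1, mul_le_of_le_one_right v1nn hs.2⟩
  have hl : LipschitzOnWith 1 (naturalParameterization f (Icc 0 1) 0) (v '' Icc 0 1) := by
    intro p hp q hq
    wlog hpq : p ≤ q generalizing p q
    · rw [edist_comm, edist_comm p]
      exact this hq hp (le_of_not_ge hpq)
    have := hunit hp hq
    rw [NNReal.coe_one, one_mul] at this
    rw [ENNReal.coe_one, one_mul, edist_comm p q, edist_dist q, Real.dist_eq, abs_of_nonneg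
      (sub_nonneg.2 hpq), ← this]
    exact eVariationOn.edist_le _ ⟨hp, left_mem_Icc.2 hpq⟩ ⟨hq, right_mem_Icc.2 hpq⟩
  refine ⟨fun s => naturalParameterization f (Icc 0 1) 0 (v 1 * s), ?_, ?_, ?_, ?_⟩
  · have h2 : LipschitzWith (v 1).toNNReal (fun s => v 1 * s) := by
      refine LipschitzWith.of_dist_le_mul fun p q => ?_
      rw [Real.dist_eq, ← mul_sub, abs_mul, abs_of_nonneg v1nn, Real.coe_toNNReal _ v1nn,
        Real.dist_eq]
    have := hl.comp (h2.lipschitzOnWith (s := Icc 0 1)) hmaps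
    rw [one_mul] at this
    exact this.weaken (Real.toNNReal_le_toNNReal vD.le)
  · intro s hs
    obtain ⟨z, hz, hz'⟩ := hmaps hs
    simp only at hz' ⊢
    rw [← hz', hpar z hz]
    exact hm hz
  · have := hpar 0 m0
    rw [v0, h0] at this
    simpa only [mul_zero] using this
  · have := hpar 1 m1
    rw [h1] at this
    simpa only [mul_one] using this

/-- A function on the network that varies by at most `ε` at scale `δ` grows at most linearly. -/
theorem abs_sub_le_of_edist_lt {f : G.Pt → ℝ} {δ ε : ℝ} (hδ : 0 < δ)
    (hf : ∀ x y : G.Pt, edist x y < ENNReal.ofReal δ → |f x - f y| ≤ ε) {x y : G.Pt} {D : ℝ}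
    (h : edist x y < ENNReal.ofReal D) : |f x - f y| ≤ (D / δ + 1) * ε := by
  have hD : 0 < D := by
    by_contra hD
    rw [ENNReal.ofReal_of_nonpos (not_lt.1 hD)] at h
    exact not_lt_bot h
  have hε : 0 ≤ ε := (abs_nonneg _).trans (hf x x (by simpa using hδ))
  obtain ⟨ζ, hL, hm, h0, h1⟩ := G.exists_lipschitz_path h
  -- The path is cut into `n` pieces, each of length at most `D / n`, which is strictly below `δ`
  -- thanks to the `+ 1`.
  set n := ⌊D / δ⌋₊ + 1 with hn
  have npos : (0 : ℝ) < n := by positivity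
  have hnD : D / n < δ := by
    rw [div_lt_comm₀ npos hδ]
    simpa [hn] using Nat.lt_floor_add_one (D / δ)
  have hmem : ∀ k : ℕ, k ≤ n → (k : ℝ) / n ∈ Icc (0 : ℝ) 1 := fun k hk =>
    ⟨by positivity, div_le_one_of_le₀ (by exact_mod_cast hk) npos.le⟩
  have step : ∀ k : ℕ, (hk : k ≤ n) →
      |f x - f (G.mkPt (ζ ((k : ℝ) / n)) (hm (hmem k hk)))| ≤ k * ε := by
    intro k
    induction k with
    | zero =>
      intro hk
      have : G.mkPt (ζ (((0 : ℕ) : ℝ) / n)) (hm (hmem 0 hk)) = x := G.mkPt_eq (by simp [h0])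
      rw [this]
      simp
    | succ k ih =>
      intro hk
      have hk' : k ≤ n := (Nat.le_succ k).trans hk
      have hle : (k : ℝ) / n ≤ ((k + 1 : ℕ) : ℝ) / n := by gcongr; simp
      have hsub : Icc ((k : ℝ) / n) (((k + 1 : ℕ) : ℝ) / n) ⊆ Icc 0 1 :=
        Icc_subset_Icc (hmem k hk').1 (hmem _ hk).2
      have hL' := hL.mono hsub
      have hac : AbsolutelyContinuousOnInterval ζ ((k : ℝ) / n) (((k + 1 : ℕ) : ℝ) / n) :=
        LipschitzOnWith.absolutelyContinuousOnInterval (by rwa [uIcc_of_le hle])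
      have hd : edist (G.mkPt (ζ ((k : ℝ) / n)) (hm (hmem k hk')))
          (G.mkPt (ζ (((k + 1 : ℕ) : ℝ) / n)) (hm (hmem _ hk))) < ENNReal.ofReal δ := by
        refine lt_of_le_of_lt (G.geodesicEDist_le_eVariationOn hle hL'.continuousOn
          (hm.mono_left hsub)) ?_
        refine lt_of_le_of_lt (hL'.comp_eVariationOn_le (g := id) (fun z hz => hz)) ?_
        have e1 : eVariationOn id (Icc ((k : ℝ) / n) (((k + 1 : ℕ) : ℝ) / n)) ≤
            ENNReal.ofReal (1 / n) := by
          have := (monotone_id.monotoneOn _).eVariationOn_eq (left_mem_Icc.2 hle)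
            (right_mem_Icc.2 hle)
          rw [inter_self] at this
          rw [this]
          refine le_of_eq ?_
          simp only [id]
          congr 1
          push_cast
          ring
        refine lt_of_le_of_lt (mul_le_mul_right e1 _) ?_
        rw [← ENNReal.ofReal, ← ENNReal.ofReal_mul hD.le, ENNReal.ofReal_lt_ofReal_iff hδ]
        simpa [div_eq_mul_inv] using hnD
      have := (abs_sub_le _ _ _).trans (add_le_add (ih hk') (hf _ _ hd))
      push_cast at this ⊢
      linarith
  have hfin := step n le_rfl
  have e : G.mkPt (ζ ((n : ℝ) / n)) (hm (hmem n le_rfl)) = y :=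
    G.mkPt_eq (by rw [div_self npos.ne', h1])
  rw [e] at hfin
  refine hfin.trans (mul_le_mul_of_nonneg_right ?_ hε)
  rw [hn]
  push_cast
  linarith [Nat.floor_le (div_nonneg hD.le hδ.le)]

end EmbeddedNetwork

/-! ### Change of time with bounded speed. -/

section TimeChange

/-- The time change with speed `w ∈ [1/2, 1]`: a bi-Lipschitz bijection of the line, together with
its inverse and the change of variables formula. -/
theorem exists_time_change {w : ℝ → ℝ} (hw : Measurable w) (hw1 : ∀ τ, 1 / 2 ≤ w τ)
    (hw2 : ∀ τ, w τ ≤ 1) :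
    ∃ ψ φ : ℝ → ℝ, (∀ τ, ψ τ = ∫ s in (0 : ℝ)..τ, w s) ∧ Monotone ψ ∧ Monotone φ ∧
      LipschitzWith 2 φ ∧ (∀ τ, φ (ψ τ) = τ) ∧ (∀ σ, ψ (φ σ) = σ) ∧
      (∀ᵐ τ, HasDerivAt ψ (w τ) τ ∧ HasDerivAt φ (w τ)⁻¹ (ψ τ)) ∧
      ∀ (F : ℝ → ℝ) (t : ℝ),
        (IntegrableOn F (Icc 0 (ψ t)) ↔ IntegrableOn (fun τ => w τ * F (ψ τ)) (Icc 0 t)) ∧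
        ∫ σ in Icc 0 (ψ t), F σ = ∫ τ in Icc 0 t, w τ * F (ψ τ) := by
  have hint : ∀ x y, IntervalIntegrable w volume x y := fun x y => by
    refine (intervalIntegrable_const (c := (1 : ℝ))).mono_fun hw.aestronglyMeasurable
      (ae_of_all _ fun τ => ?_)
    change ‖w τ‖ ≤ ‖(1 : ℝ)‖
    rw [norm_one, Real.norm_of_nonneg (by linarith [hw1 τ])]
    exact hw2 τ
  set ψ : ℝ → ℝ := fun τ => ∫ s in (0 : ℝ)..τ, w s with hψ
  have hdiff : ∀ x y, ψ y - ψ x = ∫ s in x..y, w s := fun x y =>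
    intervalIntegral.integral_interval_sub_left (hint _ _) (hint _ _)
  have hlow : ∀ x y, x ≤ y → (y - x) / 2 ≤ ψ y - ψ x := fun x y hxy => by
    have := intervalIntegral.integral_mono_on hxy (intervalIntegrable_const (c := (1 / 2 : ℝ)))
      (hint x y) fun τ _ => hw1 τ
    rw [intervalIntegral.integral_const, smul_eq_mul] at this
    rw [hdiff]
    linarith
  have hup : ∀ x y, x ≤ y → ψ y - ψ x ≤ y - x := fun x y hxy => by
    have := intervalIntegral.integral_mono_on hxy (hint x y)
      (intervalIntegrable_const (c := (1 : ℝ))) fun τ _ => hw2 τ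
    rw [intervalIntegral.integral_const, smul_eq_mul] at this
    rw [hdiff]
    linarith
  have hψ0 : ψ 0 = 0 := intervalIntegral.integral_same
  have hmono : StrictMono ψ := fun x y hxy => by linarith [hlow x y hxy.le]
  have hLψ : LipschitzWith 1 ψ := LipschitzWith.of_dist_le_mul fun x y => by
    rw [NNReal.coe_one, one_mul]
    wlog hxy : x ≤ y generalizing x y
    · rw [dist_comm, dist_comm x]
      exact this y x (le_of_not_ge hxy)
    rw [dist_comm, dist_comm x, Real.dist_eq, Real.dist_eq, abs_of_nonneg (sub_nonneg.2 hxy),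
      abs_of_nonneg (sub_nonneg.2 (hmono.monotone hxy))]
    exact hup x y hxy
  have hsurj : Function.Surjective ψ := by
    refine hLψ.continuous.surjective ?_ ?_
    · refine tendsto_atTop_mono' _ ?_ (tendsto_id.atTop_div_const (zero_lt_two' ℝ))
      filter_upwards [eventually_ge_atTop 0] with x hx
      have := hlow 0 x hx
      simp only [id]
      linarith
    · refine tendsto_atBot_mono' _ ?_ (tendsto_id.atBot_div_const (zero_lt_two' ℝ))
      filter_upwards [eventually_le_atBot 0] with x hx
      have := hlow x 0 hx
      simp only [id]
      linarith
  set e : ℝ ≃o ℝ := StrictMono.orderIsoOfSurjective ψ hmono hsurj with he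
  have e1 : ∀ τ, e.symm (ψ τ) = τ := fun τ => e.symm_apply_apply τ
  have e2 : ∀ σ, ψ (e.symm σ) = σ := fun σ => e.apply_symm_apply σ
  have hφL : LipschitzWith 2 e.symm := LipschitzWith.of_dist_le_mul fun x y => by
    wlog hxy : x ≤ y generalizing x y
    · rw [dist_comm, dist_comm x]
      exact this y x (le_of_not_ge hxy)
    have h := hlow _ _ (e.symm.monotone hxy)
    rw [e2, e2] at h
    rw [dist_comm, dist_comm x, Real.dist_eq, Real.dist_eq, abs_of_nonneg (sub_nonneg.2 hxy),
      abs_of_nonneg (sub_nonneg.2 (e.symm.monotone hxy)), NNReal.coe_ofNat]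
    linarith
  have hd : ∀ᵐ τ, HasDerivAt ψ (w τ) τ := by
    have hloc : LocallyIntegrable w volume := by
      refine locallyIntegrable_iff.2 fun K hK => ?_
      refine Integrable.mono' (g := fun _ => (1 : ℝ)) ?_ hw.aestronglyMeasurable
        (ae_of_all _ fun τ => ?_)
      · exact integrableOn_const hK.measure_lt_top.ne
      · rw [Real.norm_of_nonneg (by linarith [hw1 τ])]
        exact hw2 τ
    filter_upwards [LocallyIntegrable.ae_hasDerivAt_integral hloc] with τ hτ using hτ 0
  have hwpos : ∀ τ, 0 < w τ := fun τ => by linarith [hw1 τ]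
  refine ⟨ψ, e.symm, fun _ => rfl, hmono.monotone, e.symm.monotone, hφL, e1, e2, ?_, ?_⟩
  · filter_upwards [hd] with τ hτ
    refine ⟨hτ, HasDerivAt.of_local_left_inverse hφL.continuous.continuousAt ?_ (hwpos τ).ne'
      (Eventually.of_forall e2)⟩
    rwa [e1]
  · intro F t
    -- The change of variables formula requires differentiability at every point, so it is applied
    -- on a measurable set `D` of full measure. Nothing is lost, because the Lipschitz map `ψ` sends
    -- the null set `Dᶜ` to a null set.
    obtain ⟨D, hD, hDm, hDs⟩ : ∃ D : Set ℝ, (∀ τ ∈ D, HasDerivAt ψ (w τ) τ) ∧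
        MeasurableSet D ∧ volume Dᶜ = 0 := by
      obtain ⟨B, hB, hBm, hB0⟩ := exists_measurable_superset_of_null (ae_iff.1 hd)
      refine ⟨Bᶜ, fun τ hτ => ?_, hBm.compl, by rwa [compl_compl]⟩
      by_contra h
      exact hτ (hB h)
    have himg : ψ '' Icc 0 t = Icc 0 (ψ t) := by
      have := e.image_Icc 0 t
      have h0 : e 0 = 0 := hψ0
      rw [h0] at this
      exact this
    have hnull : volume (ψ '' Dᶜ) = 0 := by
      have := hLψ.hausdorffMeasure_image_le (d := 1) zero_le_one Dᶜ
      rw [hausdorffMeasure_real, hDs, mul_zero] at this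
      exact le_antisymm this bot_le
    have hset : ψ '' (Icc 0 t ∩ D) =ᵐ[volume] Icc 0 (ψ t) := by
      rw [← himg]
      refine ae_eq_set.2 ⟨?_, measure_mono_null ?_ hnull⟩
      · rw [sdiff_eq_empty.2 (image_mono inter_subset_left), measure_empty]
      · rintro _ ⟨⟨τ, hτ, rfl⟩, h⟩
        exact ⟨τ, fun hτD => h ⟨τ, ⟨hτ, hτD⟩, rfl⟩, rfl⟩
    have hset' : (Icc 0 t ∩ D : Set ℝ) =ᵐ[volume] Icc 0 t := by
      refine ae_eq_set.2 ⟨?_, measure_mono_null ?_ hDs⟩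
      · rw [sdiff_eq_empty.2 inter_subset_left, measure_empty]
      · rintro τ ⟨hτ, h⟩
        exact fun hτD => h ⟨hτ, hτD⟩
    have hder : ∀ τ ∈ Icc 0 t ∩ D, HasDerivWithinAt ψ (w τ) (Icc 0 t ∩ D) τ := fun τ hτ =>
      (hD τ hτ.2).hasDerivWithinAt
    have hm : MeasurableSet (Icc 0 t ∩ D) := measurableSet_Icc.inter hDm
    have habs : ∀ τ, |w τ| • F (ψ τ) = w τ * F (ψ τ) := fun τ => by
      rw [abs_of_pos (hwpos τ), smul_eq_mul]
    constructor
    · rw [← integrableOn_congr_set_ae hset, ← integrableOn_congr_set_ae hset',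
        integrableOn_image_iff_integrableOn_abs_deriv_smul hm hder hmono.injective.injOn]
      simp only [habs]
    · rw [← setIntegral_congr_set hset, ← setIntegral_congr_set hset',
        integral_image_eq_integral_abs_deriv_smul hm hder hmono.injective.injOn]
      simp only [habs]

end TimeChange

/-! ### Estimates for the Lagrangian of an arc. -/

namespace EmbeddedNetwork

/-- Beyond some `R` superlinearity makes `f ρ ≥ r ρ`; below `R` monotonicity gives `f ρ ≥ f 0`. -/
theorem IsSuperlinearBound.exists_mul_sub_le {f : ℝ → ℝ} (hf : IsSuperlinearBound f) (r : ℝ) :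
    ∃ B, 0 ≤ B ∧ ∀ ρ, 0 ≤ ρ → r * ρ - f ρ ≤ B := by
  obtain ⟨R, hR⟩ := eventually_atTop.1 (hf.2.2.eventually_ge_atTop r)
  refine ⟨max 0 (|r| * |R| - f 0), le_max_left _ _, fun ρ hρ => ?_⟩
  rcases hρ.eq_or_lt with h0 | h0
  · subst h0
    refine le_max_of_le_right ?_
    nlinarith [abs_nonneg r, abs_nonneg R, mul_nonneg (abs_nonneg r) (abs_nonneg R)]
  rcases le_total R ρ with h | h
  · have := hR ρ h
    rw [le_div_iff₀ h0] at this
    exact le_max_of_le_left (by linarith)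
  · refine le_max_of_le_right ?_
    have h1 := hf.1 (mem_Ici.2 le_rfl) (mem_Ici.2 hρ) hρ
    have h2 : r * ρ ≤ |r| * |R| :=
      mul_le_mul (le_abs_self r) (h.trans (le_abs_self R)) hρ (abs_nonneg r)
    linarith

variable {N : ℕ} {E : Type*} {G : EmbeddedNetwork N E} {H : E → ℝ → ℝ → ℝ → ℝ}
  {c : EuclideanSpace ℝ (Fin N) → ℝ → ℝ}

section Arc

variable {T : ℝ}

theorem IsHamiltonian.exists_conj_bound (hH : G.IsHamiltonian H) (hT : 0 < T) (r : ℝ) :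
    ∃ B, 0 ≤ B ∧ ∀ e, ∀ s ∈ Icc 0 (G.len e), ∀ t ∈ Icc 0 T, ∀ l, |l| ≤ r → ∀ μ,
      l * μ - H e s t μ ≤ B := by
  obtain ⟨θ, Θ, hθ, -, h⟩ := hH.coercive T hT
  obtain ⟨B, hB, hB'⟩ := hθ.exists_mul_sub_le r
  refine ⟨B, hB, fun e s hs t ht l hl μ => le_trans ?_ (hB' |μ| (abs_nonneg μ))⟩
  have h1 := (h e s hs μ t ht).1
  have h2 : l * μ ≤ r * |μ| := by
    refine (le_abs_self _).trans ?_
    rw [abs_mul]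
    exact mul_le_mul_of_nonneg_right hl (abs_nonneg μ)
  linarith

theorem IsHamiltonian.bddAbove (hH : G.IsHamiltonian H) {e : E} {s t : ℝ}
    (hs : s ∈ Icc 0 (G.len e)) (ht : 0 ≤ t) (l : ℝ) :
    BddAbove (range fun μ => l * μ - H e s t μ) := by
  obtain ⟨B, -, hB⟩ := hH.exists_conj_bound (T := t + 1) (by linarith) |l|
  refine ⟨B, ?_⟩
  rintro _ ⟨μ, rfl⟩
  exact hB e s hs t ⟨ht, by linarith⟩ l le_rfl μ

theorem IsHamiltonian.le_arcLagrangian (hH : G.IsHamiltonian H) {e : E} {s t : ℝ}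
    (hs : s ∈ Icc 0 (G.len e)) (ht : 0 ≤ t) (l μ : ℝ) :
    l * μ - H e s t μ ≤ arcLagrangian H e s l t :=
  le_ciSup (hH.bddAbove hs ht l) μ

theorem IsHamiltonian.exists_arcLagrangian_le (hH : G.IsHamiltonian H) (hT : 0 < T) (r : ℝ) :
    ∃ B, 0 ≤ B ∧ ∀ e, ∀ s ∈ Icc 0 (G.len e), ∀ t ∈ Icc 0 T, ∀ l, |l| ≤ r →
      arcLagrangian H e s l t ≤ B := by
  obtain ⟨B, hB, h⟩ := hH.exists_conj_bound hT r
  exact ⟨B, hB, fun e s hs t ht l hl => ciSup_le (h e s hs t ht l hl)⟩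

/-- Test the supremum with `μ = ±A`, the sign being that of `l`; the bound `Θ A` on the Hamiltonian
is uniform over the arcs. -/
theorem IsHamiltonian.exists_le_arcLagrangian (hH : G.IsHamiltonian H) (hT : 0 < T) {A : ℝ}
    (hA : 0 ≤ A) :
    ∃ M, 0 ≤ M ∧ ∀ e, ∀ s ∈ Icc 0 (G.len e), ∀ t ∈ Icc 0 T, ∀ l,
      A * |l| - M ≤ arcLagrangian H e s l t := by
  obtain ⟨θ, Θ, -, -, h⟩ := hH.coercive T hT
  refine ⟨max 0 (Θ A), le_max_left _ _, fun e s hs t ht l => ?_⟩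
  have hM := le_max_right 0 (Θ A)
  have habs : |A| = A := abs_of_nonneg hA
  rcases le_total 0 l with hl | hl
  · have h1 := hH.le_arcLagrangian hs ht.1 l A
    have h2 := (h e s hs A t ht).2
    rw [habs] at h2
    rw [abs_of_nonneg hl]
    linarith
  · have h1 := hH.le_arcLagrangian hs ht.1 l (-A)
    have h2 := (h e s hs (-A) t ht).2
    rw [abs_neg, habs] at h2
    rw [abs_of_nonpos hl]
    linarith

/-- For each `μ`, `l μ - (1-κ) H = (1-2κ)(l μ - H) + κ (2 l μ - H)`, with nonnegative weights since
`κ ≤ 1/2`. Accelerating by `1/(1-κ)` thus costs only `O(κ)` once `L` at `2 l` is bounded above and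
`L` at `l` below. -/
theorem IsHamiltonian.arcLagrangian_speed_up (hH : G.IsHamiltonian H) {e : E} {s t l κ : ℝ}
    (hs : s ∈ Icc 0 (G.len e)) (ht : 0 ≤ t) (hκ : κ ∈ Icc 0 (1 / 2 : ℝ)) :
    (1 - κ) * arcLagrangian H e s (l / (1 - κ)) t ≤
      (1 - 2 * κ) * arcLagrangian H e s l t + κ * arcLagrangian H e s (2 * l) t := by
  have hpos : 0 < 1 - κ := by linarith [hκ.2]
  rw [mul_comm, ← le_div_iff₀ hpos]
  refine ciSup_le fun μ => ?_
  rw [le_div_iff₀ hpos]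
  have h1 := mul_le_mul_of_nonneg_left (hH.le_arcLagrangian hs ht l μ)
    (by linarith [hκ.2] : 0 ≤ 1 - 2 * κ)
  have h2 := mul_le_mul_of_nonneg_left (hH.le_arcLagrangian hs ht (2 * l) μ) hκ.1
  have h3 : (l / (1 - κ) * μ - H e s t μ) * (1 - κ) = l * μ - (1 - κ) * H e s t μ := by
    field_simp
  rw [h3]
  linarith

/-- Only momenta with `l μ - H(t₁) ≥ -M` matter, as `-M` is already a lower bound for the Lagrangian
at `t₂`. For these, `H(t₁) / (1 + |μ|) ≤ |l| + M`, so the time-regularity hypothesis yields an error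
linear in `|l|`. This linear growth is what a bound on the length of curves can absorb. -/
theorem IsHamiltonian.exists_arcLagrangian_time (hH : G.IsHamiltonian H) (hT : 0 < T) :
    ∃ C ε : ℝ, 0 ≤ C ∧ 0 < ε ∧ ∀ e, ∀ s ∈ Icc 0 (G.len e), ∀ l, ∀ t₁ ∈ Icc 0 T, ∀ t₂ ∈ Icc 0 T,
      |t₁ - t₂| < ε → arcLagrangian H e s l t₁ - arcLagrangian H e s l t₂ ≤
        C * (1 + |l|) * |t₁ - t₂| := by
  obtain ⟨α, β, ε, hα, hβ, hε, h⟩ := hH.time_lipschitz T hT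
  obtain ⟨M, hM, hM'⟩ := hH.exists_le_arcLagrangian hT le_rfl
  refine ⟨α * (1 + M) + β, ε, by positivity, hε.1, fun e s hs l t₁ ht₁ t₂ ht₂ ht => ?_⟩
  rw [sub_le_iff_le_add']
  have hnn : 0 ≤ (α * (1 + M) + β) * (1 + |l|) * |t₁ - t₂| := by positivity
  refine ciSup_le fun μ => ?_
  have h2 := hM' e s hs t₂ ht₂ l
  rcases lt_or_ge (l * μ - H e s t₁ μ) (-M) with h3 | h3
  · linarith
  have h4 := h e s hs μ t₂ ht₂ t₁ ht₁ ht
  have h5 := hH.le_arcLagrangian hs ht₂.1 l μ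
  have h6 : H e s t₁ μ / (1 + |μ|) ≤ |l| + M := by
    rw [div_le_iff₀ (by positivity)]
    have : l * μ ≤ |l| * |μ| := by rw [← abs_mul]; exact le_abs_self _
    nlinarith [abs_nonneg l, abs_nonneg μ, mul_nonneg hM (abs_nonneg μ)]
  have h7 : α * (H e s t₁ μ / (1 + |μ|)) + β ≤ (α * (1 + M) + β) * (1 + |l|) := by
    have := mul_le_mul_of_nonneg_left h6 hα
    nlinarith [mul_nonneg hα hM, mul_nonneg hβ (abs_nonneg l),
      mul_nonneg (mul_nonneg hα hM) (abs_nonneg l), mul_nonneg hα (abs_nonneg l)]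
  have h8 := mul_le_mul_of_nonneg_right h7 (abs_nonneg (t₁ - t₂))
  linarith

end Arc

/-! ### Geometry of the arcs and well-posedness of the Lagrangian. -/

section Structure

theorem len_pos (G : EmbeddedNetwork N E) (e : E) : 0 < G.len e := by
  obtain ⟨m, hm, h⟩ := G.len_bound
  exact hm.trans_le (h e)

theorem tangent_norm {e : E} {s : ℝ} (hs : s ∈ Icc 0 (G.len e)) : ‖G.tangent e s‖ = 1 :=
  G.unit_speed e s hs

theorem abs_inner_tangent_le {e : E} {s : ℝ} (hs : s ∈ Icc 0 (G.len e))
    (q : EuclideanSpace ℝ (Fin N)) : |inner ℝ q (G.tangent e s)| ≤ ‖q‖ := by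
  have := abs_real_inner_le_norm q (G.tangent e s)
  rwa [show ‖G.tangent e s‖ = 1 from G.unit_speed e s hs, mul_one] at this

theorem hasDerivAt_curve {e : E} {s : ℝ} (hs : s ∈ Ioo 0 (G.len e)) :
    HasDerivAt (G.curve e) (G.tangent e s) s :=
  (((G.contDiffOn e).differentiableOn one_ne_zero s
    (Ioo_subset_Icc_self hs)).hasDerivWithinAt).hasDerivAt (Icc_mem_nhds hs.1 hs.2)

theorem eq_or_eq_rev_of_curve_eq {e e' : E} {s s' : ℝ} (hs : s ∈ Ioo 0 (G.len e))
    (hs' : s' ∈ Icc 0 (G.len e')) (h : G.curve e s = G.curve e' s') : e' = e ∨ e' = G.rev e := by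
  by_contra hne
  rw [not_or] at hne
  exact disjoint_left.1 (G.no_overlap e e' hne.1 hne.2) ⟨s, hs, rfl⟩ ⟨s', hs', h.symm⟩

theorem curve_injOn {e : E} {s s' : ℝ} (hs : s ∈ Ioo 0 (G.len e)) (hs' : s' ∈ Icc 0 (G.len e))
    (h : G.curve e s = G.curve e s') : s = s' := by
  rcases hs'.2.eq_or_lt with h' | h'
  · exact G.injOn_Ioc e ⟨hs.1, hs.2.le⟩ ⟨h' ▸ G.len_pos e, h'.le⟩ h
  · exact G.injOn_Ico e ⟨hs.1.le, hs.2⟩ ⟨hs'.1, h'⟩ h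

/-- Overlap is possible only between an arc and itself or its inverse, and injectivity then fixes
the parameter. All independence of the chosen arc comes from here. -/
theorem eq_or_eq_of_curve_eq {e e' : E} {s s' : ℝ} (hs : s ∈ Ioo 0 (G.len e))
    (hs' : s' ∈ Icc 0 (G.len e')) (h : G.curve e s = G.curve e' s') :
    (e' = e ∧ s' = s) ∨ (e' = G.rev e ∧ s' = G.len e - s) := by
  rcases eq_or_eq_rev_of_curve_eq hs hs' h with rfl | rfl
  · exact Or.inl ⟨rfl, (curve_injOn hs hs' h).symm⟩
  · refine Or.inr ⟨rfl, ?_⟩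
    rw [G.len_rev] at hs'
    rw [G.curve_rev e s' hs'] at h
    have := curve_injOn hs ⟨by linarith [hs'.2], by linarith [hs'.1]⟩ h
    linarith

theorem curve_notMem_vertices {e : E} {s : ℝ} (hs : s ∈ Ioo 0 (G.len e)) :
    G.curve e s ∉ G.vertices := by
  rintro ⟨e', h | h⟩
  · rcases eq_or_eq_of_curve_eq hs (left_mem_Icc.2 (G.len_pos e').le) h with h | h <;>
      linarith [hs.1, hs.2, h.2]
  · rcases eq_or_eq_of_curve_eq hs (right_mem_Icc.2 (G.len_pos e').le) h with ⟨rfl, h⟩ | ⟨rfl, h⟩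
    · linarith [hs.2]
    · rw [G.len_rev] at h
      linarith [hs.1]

theorem mem_vertices_or_of_mem_carrier {x : EuclideanSpace ℝ (Fin N)} (hx : x ∈ G.carrier) :
    x ∈ G.vertices ∨ ∃ e, ∃ s ∈ Ioo 0 (G.len e), G.curve e s = x := by
  obtain ⟨e, s, hs, rfl⟩ := mem_iUnion.1 hx
  rcases hs.1.eq_or_lt with h0 | h0
  · exact Or.inl ⟨e, Or.inl (by rw [← h0])⟩
  rcases hs.2.eq_or_lt with h1 | h1
  · exact Or.inl ⟨e, Or.inr (by rw [h1])⟩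
  · exact Or.inr ⟨e, s, ⟨h0, h1⟩, rfl⟩

theorem tangent_rev {e : E} {s : ℝ} (hs : s ∈ Ioo 0 (G.len e)) :
    G.tangent (G.rev e) (G.len e - s) = -G.tangent e s := by
  have hs' : G.len e - s ∈ Ioo 0 (G.len (G.rev e)) := by
    rw [G.len_rev]; constructor <;> linarith [hs.1, hs.2]
  have h1 := hasDerivAt_curve hs'
  have h2 : HasDerivAt (fun r => G.curve e (G.len e - r)) (-G.tangent e s) (G.len e - s) := by
    refine HasDerivAt.comp_const_sub _ _ ?_
    rw [sub_sub_cancel]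
    exact hasDerivAt_curve hs
  refine (h1.congr_of_eventuallyEq ?_).unique h2
  rw [G.len_rev] at hs'
  filter_upwards [Icc_mem_nhds hs'.1 hs'.2] with r hr
  exact (G.curve_rev e r hr).symm

theorem lagrangian_vertex {x : EuclideanSpace ℝ (Fin N)} (hx : x ∈ G.vertices)
    (q : EuclideanSpace ℝ (Fin N)) (t : ℝ) : G.lagrangian H c x q t = ‖q‖ ^ 2 / 2 + c x t := by
  rw [lagrangian, if_pos hx]

/-- The arc chosen in `lagrangian` is `e` or its inverse. Inversion changes the sign of the tangent,
which the substitution `μ ↦ -μ` in the supremum compensates through `compat`. -/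
theorem IsHamiltonian.lagrangian_curve (hH : G.IsHamiltonian H) {e : E} {s t : ℝ}
    (hs : s ∈ Ioo 0 (G.len e)) (ht : 0 ≤ t) (q : EuclideanSpace ℝ (Fin N)) :
    G.lagrangian H c (G.curve e s) q t =
      arcLagrangian H e s (inner ℝ q (G.tangent e s)) t := by
  have hex : ∃ p : E × ℝ, p.2 ∈ Ioo 0 (G.len p.1) ∧ G.curve p.1 p.2 = G.curve e s :=
    ⟨(e, s), hs, rfl⟩
  rw [lagrangian, if_neg (curve_notMem_vertices hs), dif_pos hex]
  have hp := hex.choose_spec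
  set p := hex.choose
  obtain ⟨e', s'⟩ := p
  simp only at hp ⊢
  rcases eq_or_eq_of_curve_eq hs (Ioo_subset_Icc_self hp.1) hp.2.symm with ⟨rfl, rfl⟩ | ⟨rfl, rfl⟩
  · rfl
  · have hI : G.len e - s ∈ Icc 0 (G.len e) := ⟨by linarith [hs.2], by linarith [hs.1]⟩
    rw [tangent_rev hs, inner_neg_right, arcLagrangian, arcLagrangian,
      ← (Equiv.neg ℝ).iSup_comp]
    refine iSup_congr fun μ => ?_
    rw [hH.compat e _ hI t ht, sub_sub_cancel]
    simp

end Structure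

/-! ### Uniform estimates for the overall Lagrangian. -/

section Bounds

variable {T : ℝ}

/-- `q` is an admissible velocity at the point `x` of the network: at a vertex there is no
restriction, in the interior of an arc `q` is tangent to the arc. -/
def IsAdmissibleVelocity (G : EmbeddedNetwork N E) (x q : EuclideanSpace ℝ (Fin N)) : Prop :=
  x ∈ G.vertices ∨ ∃ e, ∃ s ∈ Ioo 0 (G.len e), ∃ k : ℝ, G.curve e s = x ∧ q = k • G.tangent e s

theorem exists_lagrangian_le (hH : G.IsHamiltonian H) (hc : G.IsFluxLimiter H c) (hT : 0 < T)
    (r : ℝ) : ∃ B, 0 ≤ B ∧ ∀ x ∈ G.carrier, ∀ q, ‖q‖ ≤ r → ∀ t ∈ Icc 0 T,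
      G.lagrangian H c x q t ≤ B := by
  obtain ⟨B, hB, h⟩ := hH.exists_arcLagrangian_le hT r
  obtain ⟨C, hC⟩ := hc.bound T hT
  refine ⟨max B (r ^ 2 / 2 + C), le_max_of_le_left hB, fun x hx q hq t ht => ?_⟩
  rcases mem_vertices_or_of_mem_carrier hx with hv | ⟨e, s, hs, rfl⟩
  · rw [lagrangian_vertex hv]
    have h1 := (abs_le.1 (hC x hv t ht)).2
    have h2 := pow_le_pow_left₀ (norm_nonneg q) hq 2
    exact le_max_of_le_right (by linarith)
  · rw [hH.lagrangian_curve hs ht.1]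
    have hs' := Ioo_subset_Icc_self hs
    exact le_max_of_le_left (h e s hs' t ht _ ((abs_inner_tangent_le hs' q).trans hq))

theorem exists_le_lagrangian (hH : G.IsHamiltonian H) (hc : G.IsFluxLimiter H c) (hT : 0 < T) :
    ∃ M, 0 ≤ M ∧ ∀ x ∈ G.carrier, ∀ q, ∀ t ∈ Icc 0 T, -M ≤ G.lagrangian H c x q t := by
  obtain ⟨M, hM, h⟩ := hH.exists_le_arcLagrangian hT le_rfl
  obtain ⟨C, hC⟩ := hc.bound T hT
  refine ⟨max M C, le_max_of_le_left hM, fun x hx q t ht => ?_⟩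
  rcases mem_vertices_or_of_mem_carrier hx with hv | ⟨e, s, hs, rfl⟩
  · rw [lagrangian_vertex hv]
    have h1 := (abs_le.1 (hC x hv t ht)).1
    have h2 := le_max_right M C
    have h3 := sq_nonneg ‖q‖
    linarith
  · rw [hH.lagrangian_curve hs ht.1]
    have h1 := h e s (Ioo_subset_Icc_self hs) t ht (inner ℝ q (G.tangent e s))
    have h2 := le_max_left M C
    linarith

/-- Inside an arc the Lagrangian sees only the tangential component of `q`, so growth in `‖q‖` needs
an admissible velocity. At a vertex it follows from `(‖q‖ - A)² ≥ 0`. -/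
theorem exists_norm_le_lagrangian (hH : G.IsHamiltonian H) (hc : G.IsFluxLimiter H c)
    (hT : 0 < T) {A : ℝ} (hA : 0 ≤ A) :
    ∃ M, 0 ≤ M ∧ ∀ x q, G.IsAdmissibleVelocity x q → ∀ t ∈ Icc 0 T,
      A * ‖q‖ - M ≤ G.lagrangian H c x q t := by
  obtain ⟨M, hM, h⟩ := hH.exists_le_arcLagrangian hT hA
  obtain ⟨C, hC⟩ := hc.bound T hT
  refine ⟨max M (A ^ 2 / 2 + C), le_max_of_le_left hM, fun x q hx t ht => ?_⟩
  rcases hx with hv | ⟨e, s, hs, k, rfl, rfl⟩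
  · rw [lagrangian_vertex hv]
    have h1 := (abs_le.1 (hC x hv t ht)).1
    have h2 := le_max_right M (A ^ 2 / 2 + C)
    have h3 := sq_nonneg (‖q‖ - A)
    linarith
  · have hs' := Ioo_subset_Icc_self hs
    rw [hH.lagrangian_curve hs ht.1, inner_smul_left, real_inner_self_eq_norm_sq, norm_smul,
      tangent_norm hs']
    have h1 := h e s hs' t ht k
    have h2 := le_max_left M (A ^ 2 / 2 + C)
    simp only [conj_trivial, one_pow, mul_one, Real.norm_eq_abs]
    linarith

theorem exists_lagrangian_speed_up (hH : G.IsHamiltonian H) (hc : G.IsFluxLimiter H c)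
    (hT : 0 < T) (r : ℝ) :
    ∃ C, 0 ≤ C ∧ ∀ x ∈ G.carrier, ∀ q, ‖q‖ ≤ r → ∀ t ∈ Icc 0 T, ∀ κ ∈ Icc 0 (1 / 2 : ℝ),
      (1 - κ) * G.lagrangian H c x ((1 - κ)⁻¹ • q) t ≤ G.lagrangian H c x q t + κ * C := by
  obtain ⟨B, hB, h⟩ := hH.exists_arcLagrangian_le hT (2 * r)
  obtain ⟨M, hM, h'⟩ := hH.exists_le_arcLagrangian hT le_rfl
  obtain ⟨C, hC⟩ := hc.bound T hT
  -- On an arc, `(1-2κ) L + κ B ≤ L + κ (B + 2 M)`. At a vertex, `(1-κ)⁻¹ ≤ 1 + 2 κ` costs at most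
  -- `κ r²` and the flux limiter at most `κ C`.
  refine ⟨max (B + 2 * M) (r ^ 2 + C), le_max_of_le_left (by positivity),
    fun x hx q hq t ht κ hκ => ?_⟩
  have hpos : 0 < 1 - κ := by linarith [hκ.2]
  rcases mem_vertices_or_of_mem_carrier hx with hv | ⟨e, s, hs, rfl⟩
  · rw [lagrangian_vertex hv, lagrangian_vertex hv, norm_smul, Real.norm_of_nonneg
      (inv_nonneg.2 hpos.le)]
    have h1 := (abs_le.1 (hC x hv t ht)).1
    have h2 := pow_le_pow_left₀ (norm_nonneg q) hq 2
    have h3 := mul_le_mul_of_nonneg_left (le_max_right (B + 2 * M) (r ^ 2 + C)) hκ.1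
    have h4 : (1 - κ) * (((1 - κ)⁻¹ * ‖q‖) ^ 2 / 2 + c x t) =
        (1 - κ)⁻¹ * (‖q‖ ^ 2 / 2) + (1 - κ) * c x t := by field_simp
    have h5 : (1 - κ)⁻¹ ≤ 1 + 2 * κ := by
      rw [inv_le_iff_one_le_mul₀ hpos]
      nlinarith [hκ.1, hκ.2]
    rw [h4]
    have h6 := mul_le_mul_of_nonneg_right h5 (by positivity : 0 ≤ ‖q‖ ^ 2 / 2)
    have h7 := mul_le_mul_of_nonneg_left h2 hκ.1
    have h8 := mul_le_mul_of_nonneg_left h1 hκ.1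
    linarith
  · have hs' := Ioo_subset_Icc_self hs
    rw [hH.lagrangian_curve hs ht.1, hH.lagrangian_curve hs ht.1, inner_smul_left, conj_trivial,
      inv_mul_eq_div]
    set l := inner ℝ q (G.tangent e s)
    have hl : |2 * l| ≤ 2 * r := by
      rw [abs_mul, abs_two]
      linarith [(abs_inner_tangent_le hs' q).trans hq]
    have h1 := hH.arcLagrangian_speed_up (l := l) hs' ht.1 hκ
    have h2 := mul_le_mul_of_nonneg_left (h e s hs' t ht _ hl) hκ.1
    have h3 := mul_le_mul_of_nonneg_left (h' e s hs' t ht l) hκ.1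
    have h4 := mul_le_mul_of_nonneg_left (le_max_left (B + 2 * M) (r ^ 2 + C)) hκ.1
    linarith

theorem exists_lagrangian_time (hH : G.IsHamiltonian H) (hc : G.IsFluxLimiter H c)
    (hT : 0 < T) :
    ∃ C ε : ℝ, 0 ≤ C ∧ 0 < ε ∧ ∀ x ∈ G.carrier, ∀ q, ∀ t₁ ∈ Icc 0 T, ∀ t₂ ∈ Icc 0 T,
      |t₁ - t₂| < ε → G.lagrangian H c x q t₁ - G.lagrangian H c x q t₂ ≤
        C * (1 + ‖q‖) * |t₁ - t₂| := by
  obtain ⟨C, ε, hC, hε, h⟩ := hH.exists_arcLagrangian_time hT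
  obtain ⟨β, ε', hβ, hε', h'⟩ := hc.time_lipschitz T hT
  refine ⟨max C β, min ε ε', le_max_of_le_left hC, lt_min hε hε'.1,
    fun x hx q t₁ ht₁ t₂ ht₂ ht => ?_⟩
  rcases mem_vertices_or_of_mem_carrier hx with hv | ⟨e, s, hs, rfl⟩
  · rw [lagrangian_vertex hv, lagrangian_vertex hv]
    have h1 := h' x hv t₁ ht₁ t₂ ht₂ (by rw [abs_sub_comm]; exact ht.trans_le (min_le_right _ _))
    rw [abs_sub_comm t₂] at h1
    have h2 : β ≤ max C β * (1 + ‖q‖) := by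
      have := mul_nonneg (le_max_of_le_right hβ : 0 ≤ max C β) (norm_nonneg q)
      linarith [le_max_right C β]
    have h3 := mul_le_mul_of_nonneg_right h2 (abs_nonneg (t₁ - t₂))
    linarith
  · have hs' := Ioo_subset_Icc_self hs
    rw [hH.lagrangian_curve hs ht₁.1, hH.lagrangian_curve hs ht₂.1]
    refine (h e s hs' _ t₁ ht₁ t₂ ht₂ (ht.trans_le (min_le_left _ _))).trans ?_
    gcongr
    · exact le_max_left _ _
    · exact abs_inner_tangent_le hs' q

end Bounds

end EmbeddedNetwork

namespace EmbeddedNetwork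

variable {N : ℕ} {E : Type*} {G : EmbeddedNetwork N E} {H : E → ℝ → ℝ → ℝ → ℝ}
  {c : EuclideanSpace ℝ (Fin N) → ℝ → ℝ}

/-! ### Borel dependence of the arc length parameter on the point. -/

section Parameter

theorem continuousOn_curve (G : EmbeddedNetwork N E) (e : E) :
    ContinuousOn (G.curve e) (Icc 0 (G.len e)) := (G.contDiffOn e).continuousOn

theorem curve_injOn_Ioo (G : EmbeddedNetwork N E) (e : E) :
    InjOn (G.curve e) (Ioo 0 (G.len e)) :=
  (G.injOn_Ico e).mono Ioo_subset_Ico_self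

theorem measurableSet_openArc (G : EmbeddedNetwork N E) (e : E) :
    MeasurableSet (G.curve e '' Ioo 0 (G.len e)) :=
  measurableSet_Ioo.image_of_continuousOn_injOn
    ((G.continuousOn_curve e).mono Ioo_subset_Icc_self) (G.curve_injOn_Ioo e)

/-- The arc length parameter of the points of an open arc, as a Borel function. -/
theorem exists_measurable_param (G : EmbeddedNetwork N E) (e : E) :
    ∃ σ : EuclideanSpace ℝ (Fin N) → ℝ, Measurable σ ∧
      ∀ s ∈ Ioo 0 (G.len e), σ (G.curve e s) = s := by
  have hemb := ContinuousOn.measurableEmbedding measurableSet_Ioo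
    ((G.continuousOn_curve e).mono Ioo_subset_Icc_self) (G.curve_injOn_Ioo e)
  obtain ⟨σ, hσ, h⟩ := hemb.exists_measurable_extend
    (g := fun s : Ioo 0 (G.len e) => (s : ℝ)) measurable_subtype_coe fun _ => ⟨0⟩
  exact ⟨σ, hσ, fun s hs => congrFun h ⟨s, hs⟩⟩

/-- If points of an open arc converge to a point of this arc, so do their parameters. -/
theorem tendsto_param {ι : Type*} {F : Filter ι} {e : E} {p : ι → ℝ} {s : ℝ}
    (hs : s ∈ Ioo 0 (G.len e)) (hp : ∀ᶠ i in F, p i ∈ Icc 0 (G.len e))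
    (h : Tendsto (fun i => G.curve e (p i)) F (𝓝 (G.curve e s))) : Tendsto p F (𝓝 s) := by
  intro U hU
  -- By compactness, the points with parameter away from `s` form a closed set, which misses `curve
  -- e s` by injectivity.
  have hK : IsCompact (Icc 0 (G.len e) \ interior U) := isCompact_Icc.diff isOpen_interior
  have hcl : IsClosed (G.curve e '' (Icc 0 (G.len e) \ interior U)) :=
    (hK.image_of_continuousOn ((G.continuousOn_curve e).mono sdiff_subset)).isClosed
  have hnot : G.curve e s ∉ G.curve e '' (Icc 0 (G.len e) \ interior U) := by
    rintro ⟨s', hs', heq⟩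
    rw [← curve_injOn hs hs'.1 heq.symm] at hs'
    exact hs'.2 (mem_interior_iff_mem_nhds.2 hU)
  have h' : ∀ᶠ i in F, G.curve e (p i) ∈ (G.curve e '' (Icc 0 (G.len e) \ interior U))ᶜ :=
    h (hcl.isOpen_compl.mem_nhds hnot)
  change ∀ᶠ i in F, p i ∈ U
  filter_upwards [hp, h'] with i hi hi'
  by_contra hU'
  exact hi' ⟨p i, ⟨hi, fun h' => hU' (interior_subset h')⟩, rfl⟩

end Parameter

/-! ### Velocities of curves in the network are almost everywhere tangent. -/

section Velocity

variable {ξ : ℝ → EuclideanSpace ℝ (Fin N)}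

/-- Along times of `S` decreasing to `τ`, the difference quotients of `ξ` are multiples of secant
slopes of the arc, and these tend to the unit tangent. The scalar factors converge too, as seen by
pairing with the tangent. Accumulation from the right replaces any openness of the set of times
spent in the arc. -/
theorem deriv_eq_smul_tangent {e : E} {S : Set ℝ} {τ : ℝ} {q : EuclideanSpace ℝ (Fin N)}
    (hS : ∀ τ ∈ S, ξ τ ∈ G.curve e '' Ioo 0 (G.len e)) (hτ : τ ∈ S)
    (hiso : (𝓝[S ∩ Ioi τ] τ).NeBot) (hd : HasDerivAt ξ q τ) :
    ∃ s ∈ Ioo 0 (G.len e), ∃ k : ℝ, G.curve e s = ξ τ ∧ q = k • G.tangent e s := by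
  obtain ⟨σ, -, hσ⟩ := G.exists_measurable_param e
  obtain ⟨s, hs, hsτ⟩ := hS τ hτ
  set F := 𝓝[S ∩ Ioi τ] τ
  have hpar : ∀ τ' ∈ S, σ (ξ τ') ∈ Ioo 0 (G.len e) ∧ G.curve e (σ (ξ τ')) = ξ τ' := by
    intro τ' h'
    obtain ⟨s', hs', h⟩ := hS τ' h'
    rw [← h, hσ s' hs']
    exact ⟨hs', rfl⟩
  have hmem : ∀ᶠ τ' in F, τ' ∈ S ∩ Ioi τ := self_mem_nhdsWithin
  have hlim : Tendsto (fun τ' => σ (ξ τ')) F (𝓝 s) := by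
    refine tendsto_param hs (hmem.mono fun τ' h => Ioo_subset_Icc_self (hpar τ' h.1).1) ?_
    rw [hsτ]
    refine Tendsto.congr' (hmem.mono fun τ' h => (hpar τ' h.1).2.symm) ?_
    exact hd.continuousAt.tendsto.mono_left nhdsWithin_le_nhds
  set v := G.tangent e s
  have hcurve := hasDerivAt_curve hs
  have hm : Tendsto (fun τ' => dslope (G.curve e) s (σ (ξ τ'))) F (𝓝 v) := by
    have h := (continuousAt_dslope_same.2 hcurve.differentiableAt).tendsto
    rw [dslope_same, hcurve.deriv] at h
    exact h.comp hlim
  have hslope : Tendsto (slope ξ τ) F (𝓝 q) := by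
    refine (hasDerivAt_iff_tendsto_slope.1 hd).mono_left (nhdsWithin_mono _ ?_)
    exact fun x hx => (mem_Ioi.1 hx.2).ne'
  have heq : ∀ᶠ τ' in F, slope ξ τ τ' =
      ((σ (ξ τ') - s) / (τ' - τ)) • dslope (G.curve e) s (σ (ξ τ')) := by
    filter_upwards [hmem] with τ' h
    rw [slope, vsub_eq_sub, ← hsτ, ← (hpar τ' h.1).2, hσ _ (hpar τ' h.1).1, ← sub_smul_dslope,
      smul_smul, div_eq_inv_mul]
  have hv : inner ℝ v v = (1 : ℝ) := by
    rw [real_inner_self_eq_norm_sq, tangent_norm (Ioo_subset_Icc_self hs), one_pow]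
  have h1 : Tendsto (fun τ' => inner ℝ (dslope (G.curve e) s (σ (ξ τ'))) v) F (𝓝 (1 : ℝ)) := by
    have := hm.inner (𝕜 := ℝ) (tendsto_const_nhds (x := v))
    rwa [hv] at this
  have h2 : Tendsto (fun τ' => inner ℝ (slope ξ τ τ') v) F (𝓝 (inner ℝ q v)) :=
    hslope.inner (𝕜 := ℝ) tendsto_const_nhds
  have h3 : Tendsto (fun τ' => (σ (ξ τ') - s) / (τ' - τ)) F (𝓝 (inner ℝ q v)) := by
    have h := h2.div h1 one_ne_zero
    rw [div_one] at h
    refine h.congr' ?_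
    filter_upwards [heq, h1.eventually_ne one_ne_zero] with τ' h4 h5
    rw [Pi.div_apply, h4, inner_smul_left, conj_trivial, mul_div_assoc, div_self h5, mul_one]
  have h4 := (h3.smul hm).congr' (heq.mono fun _ h => h.symm)
  exact ⟨s, hs, inner ℝ q v, hsτ, tendsto_nhds_unique hslope h4⟩

/-- The points of a subset of the line that are isolated from the right are countable, hence null;
there are countably many arcs. -/
theorem ae_isAdmissibleVelocity [Countable E] {a b : ℝ} (hab : a ≤ b)
    (hξ : AbsolutelyContinuousOnInterval ξ a b) (hm : MapsTo ξ (Icc a b) G.carrier) :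
    ∀ᵐ τ ∂volume.restrict (Icc a b), G.IsAdmissibleVelocity (ξ τ) (deriv ξ τ) := by
  have hcount : ∀ᵐ τ, ∀ e, τ ∉ {τ ∈ Icc a b ∩ ξ ⁻¹' (G.curve e '' Ioo 0 (G.len e)) |
      𝓝[(Icc a b ∩ ξ ⁻¹' (G.curve e '' Ioo 0 (G.len e))) ∩ Ioi τ] τ = ⊥} :=
    ae_all_iff.2 fun e =>
      measure_eq_zero_iff_ae_notMem.1 (countable_setOfPred_isolated_right_within.measure_zero _)
  filter_upwards [ae_restrict_of_ae hξ.ae_differentiableAt_euclidean, ae_restrict_of_ae hcount,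
    ae_restrict_mem measurableSet_Icc] with τ hd hc hτ
  rw [uIcc_of_le hab] at hd
  rcases mem_vertices_or_of_mem_carrier (hm hτ) with hv | ⟨e, s, hs, h⟩
  · exact Or.inl hv
  · have hS : τ ∈ Icc a b ∩ ξ ⁻¹' (G.curve e '' Ioo 0 (G.len e)) := ⟨hτ, s, hs, h⟩
    refine Or.inr ⟨e, deriv_eq_smul_tangent (fun τ h => h.2) hS ⟨fun h' => hc e ⟨hS, h'⟩⟩
      (hd hτ).hasDerivAt⟩

end Velocity

/-! ### Measurability of the Lagrangian along a curve. -/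

section Measurability

/-- Continuity in `μ` makes rational momenta sufficient; a countable supremum is visibly measurable.
-/
theorem IsHamiltonian.arcLagrangian_eq_iSup_rat (hH : G.IsHamiltonian H) {e : E} {s t : ℝ}
    (hs : s ∈ Icc 0 (G.len e)) (ht : 0 ≤ t) (l : ℝ) :
    arcLagrangian H e s l t = ⨆ r : ℚ, (l * r - H e s t r) := by
  have hbdd : BddAbove (range fun r : ℚ => l * r - H e s t r) := by
    obtain ⟨B, hB⟩ := hH.bddAbove hs ht l
    refine ⟨B, ?_⟩
    rintro _ ⟨r, rfl⟩
    exact hB ⟨(r : ℝ), rfl⟩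
  refine le_antisymm (ciSup_le fun μ => ?_) (ciSup_le fun r => hH.le_arcLagrangian hs ht l r)
  have hcont : Continuous fun μ => l * μ - H e s t μ := by
    have := (hH.continuousOn e).comp_continuous (f := fun μ : ℝ => (s, t, μ)) (by fun_prop)
      fun μ => ⟨hs, ht, mem_univ _⟩
    exact (continuous_const.mul continuous_id).sub this
  refine Rat.isDenseEmbedding_coe_real.dense.induction_on
    (p := fun μ => l * μ - H e s t μ ≤ ⨆ r : ℚ, (l * r - H e s t r)) μ
    (isClosed_le hcont continuous_const) fun r => le_ciSup hbdd r

theorem countable_vertices [Countable E] (G : EmbeddedNetwork N E) : G.vertices.Countable := by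
  have : G.vertices = (range fun e => G.curve e 0) ∪ range fun e => G.curve e (G.len e) := by
    ext x
    simp only [vertices, mem_ofPred_eq, mem_union, mem_range, exists_or, eq_comm]
  rw [this]
  exact (countable_range _).union (countable_range _)

theorem aemeasurable_lagrangian [Countable E] (hH : G.IsHamiltonian H)
    (hc : G.IsFluxLimiter H c) {ξ : ℝ → EuclideanSpace ℝ (Fin N)} {a b : ℝ} (ha : 0 ≤ a)
    (hab : a ≤ b) (hξ : ContinuousOn ξ (Icc a b)) (hm : MapsTo ξ (Icc a b) G.carrier) :
    AEMeasurable (fun τ => G.lagrangian H c (ξ τ) (deriv ξ τ) τ) (volume.restrict (Icc a b)) := by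
  -- The curve, the parameter and the time are clamped to their domains, so that globally measurable
  -- functions can be built. They agree with the original data on each of the countably many pieces:
  -- times in an open arc, and times at a given vertex.
  set η : ℝ → EuclideanSpace ℝ (Fin N) := fun τ => ξ (projIcc a b hab τ) with hη
  have hηc : Continuous η := hξ.comp_continuous (by fun_prop) fun τ => (projIcc a b hab τ).2
  have hηξ : ∀ τ ∈ Icc a b, η τ = ξ τ := fun τ hτ => by simp only [hη, projIcc_of_mem hab hτ]
  have hcov : Icc a b = (⋃ e, Icc a b ∩ η ⁻¹' (G.curve e '' Ioo 0 (G.len e))) ∪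
      ⋃ v : G.vertices, Icc a b ∩ η ⁻¹' {v.1} := by
    ext τ
    simp only [mem_union, mem_iUnion, mem_inter_iff]
    refine ⟨fun hτ => ?_, ?_⟩
    · rcases mem_vertices_or_of_mem_carrier (hm hτ) with hv | ⟨e, s, hs, h⟩
      · exact Or.inr ⟨⟨ξ τ, hv⟩, hτ, hηξ τ hτ⟩
      · exact Or.inl ⟨e, hτ, s, hs, by rw [h, hηξ τ hτ]⟩
    · rintro (⟨_, h⟩ | ⟨_, h⟩) <;> exact h.1
  have hcount := G.countable_vertices.to_subtype
  have hderiv := measurable_deriv ξ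
  rw [hcov]
  refine aemeasurable_union_iff.2
    ⟨aemeasurable_iUnion_iff.2 fun e => ?_, aemeasurable_iUnion_iff.2 fun v => ?_⟩
  · have hset : MeasurableSet (Icc a b ∩ η ⁻¹' (G.curve e '' Ioo 0 (G.len e))) :=
      measurableSet_Icc.inter (hηc.measurable (G.measurableSet_openArc e))
    obtain ⟨σ, hσm, hσ⟩ := G.exists_measurable_param e
    have hlen := (G.len_pos e).le
    set P : ℝ → ℝ := fun τ => projIcc 0 (G.len e) hlen (σ (η τ)) with hP
    have hPm : Measurable P := by
      have : Continuous fun s => (projIcc 0 (G.len e) hlen s : ℝ) := by fun_prop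
      exact this.measurable.comp (hσm.comp hηc.measurable)
    have htan : Measurable fun τ => G.tangent e (P τ) := by
      have hct : ContinuousOn (G.tangent e) (Icc 0 (G.len e)) :=
        (G.contDiffOn e).continuousOn_derivWithin (uniqueDiffOn_Icc (G.len_pos e)) le_rfl
      have : Continuous fun s => G.tangent e (projIcc 0 (G.len e) hlen s) :=
        hct.comp_continuous (by fun_prop) fun s => (projIcc 0 (G.len e) hlen s).2
      exact this.measurable.comp (hσm.comp hηc.measurable)
    have hHm : ∀ r : ℚ, Measurable fun τ => H e (P τ) (max τ 0) r := fun r => by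
      have : Continuous fun p : ℝ × ℝ =>
          H e (projIcc 0 (G.len e) hlen p.1) (max p.2 0) r :=
        (hH.continuousOn e).comp_continuous
          (f := fun p : ℝ × ℝ => ((projIcc 0 (G.len e) hlen p.1 : ℝ), max p.2 0, (r : ℝ)))
          (by fun_prop)
          fun p => ⟨(projIcc 0 (G.len e) hlen p.1).2, mem_Ici.2 (le_max_right _ _), mem_univ _⟩
      exact this.measurable.comp ((hσm.comp hηc.measurable).prodMk measurable_id)
    have hf : Measurable fun τ => ⨆ r : ℚ,
        (inner ℝ (deriv ξ τ) (G.tangent e (P τ)) * (r : ℝ) - H e (P τ) (max τ 0) r) :=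
      Measurable.iSup fun r => ((hderiv.inner htan).mul_const _).sub (hHm r)
    refine hf.aemeasurable.congr ?_
    filter_upwards [ae_restrict_mem hset] with τ hτ
    obtain ⟨hτ', s, hs, h⟩ := hτ
    have hτ0 : 0 ≤ τ := ha.trans hτ'.1
    have hs' := Ioo_subset_Icc_self hs
    have hPs : P τ = s := by simp only [hP, ← h, hσ s hs, projIcc_of_mem hlen hs']
    rw [hPs, max_eq_left hτ0, ← hH.arcLagrangian_eq_iSup_rat hs' hτ0, ← hηξ τ hτ', ← h,
      hH.lagrangian_curve hs hτ0]
  · have hset : MeasurableSet (Icc a b ∩ η ⁻¹' {v.1}) :=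
      measurableSet_Icc.inter (hηc.measurable (measurableSet_singleton _))
    have hcm : Measurable fun τ => c v.1 (max τ 0) :=
      ((hc.continuousOn v.1 v.2).comp_continuous (by fun_prop) fun τ =>
        le_max_right τ 0).measurable
    have hf : Measurable fun τ => ‖deriv ξ τ‖ ^ 2 / 2 + c v.1 (max τ 0) :=
      ((hderiv.norm.pow_const 2).div_const 2).add hcm
    refine hf.aemeasurable.congr ?_
    filter_upwards [ae_restrict_mem hset] with τ hτ
    obtain ⟨hτ', h⟩ := hτ
    rw [max_eq_left (ha.trans hτ'.1), ← hηξ τ hτ', show η τ = v.1 from h, lagrangian_vertex v.2]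

end Measurability

end EmbeddedNetwork

namespace EmbeddedNetwork

variable {N : ℕ} {E : Type*} {G : EmbeddedNetwork N E} {H : E → ℝ → ℝ → ℝ → ℝ}
  {c : EuclideanSpace ℝ (Fin N) → ℝ → ℝ} {u₀ : G.Pt → ℝ}

/-! ### Reduction of the value function to a real infimum. -/

section Action

variable {ξ : ℝ → EuclideanSpace ℝ (Fin N)} {a b : ℝ}

theorem action_eq_integral
    (hi : IntegrableOn (fun τ => G.lagrangian H c (ξ τ) (deriv ξ τ) τ) (Icc a b)) :
    G.action H c a b ξ = ((∫ τ in Icc a b, G.lagrangian H c (ξ τ) (deriv ξ τ) τ : ℝ) : EReal) := by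
  have h1 : ∫⁻ τ in Icc a b, ENNReal.ofReal (G.lagrangian H c (ξ τ) (deriv ξ τ) τ) ≠ ⊤ :=
    hi.lintegral_lt_top.ne
  have h2 : ∫⁻ τ in Icc a b, ENNReal.ofReal (-G.lagrangian H c (ξ τ) (deriv ξ τ) τ) ≠ ⊤ :=
    hi.neg.lintegral_lt_top.ne
  rw [integral_eq_lintegral_pos_part_sub_lintegral_neg_part hi, EReal.coe_sub,
    EReal.coe_ennreal_toReal h1, EReal.coe_ennreal_toReal h2, action]

/-- The Lagrangian is measurable and bounded below, so its negative part has finite integral;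
failure of integrability can only come from the positive part. -/
theorem action_eq_top [Countable E] (hH : G.IsHamiltonian H) (hc : G.IsFluxLimiter H c)
    (ha : 0 ≤ a) (hab : a ≤ b) (hξ : ContinuousOn ξ (Icc a b)) (hm : MapsTo ξ (Icc a b) G.carrier)
    (hi : ¬IntegrableOn (fun τ => G.lagrangian H c (ξ τ) (deriv ξ τ) τ) (Icc a b)) :
    G.action H c a b ξ = ⊤ := by
  have hmeas := aemeasurable_lagrangian hH hc ha hab hξ hm
  obtain ⟨M, hM, hM'⟩ := exists_le_lagrangian hH hc (T := b + 1) (by linarith)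
  have hneg : ∫⁻ τ in Icc a b, ENNReal.ofReal (-G.lagrangian H c (ξ τ) (deriv ξ τ) τ) ≠ ⊤ := by
    refine ne_top_of_le_ne_top (b := ENNReal.ofReal M * volume (Icc a b)) ?_ ?_
    · exact ENNReal.mul_ne_top ENNReal.ofReal_ne_top (by simp)
    · rw [← setLIntegral_const]
      refine setLIntegral_mono' measurableSet_Icc fun τ hτ => ENNReal.ofReal_le_ofReal ?_
      have := hM' (ξ τ) (hm hτ) (deriv ξ τ) τ ⟨ha.trans hτ.1, by linarith [hτ.2]⟩
      linarith
  have hpos : ∫⁻ τ in Icc a b, ENNReal.ofReal (G.lagrangian H c (ξ τ) (deriv ξ τ) τ) = ⊤ := by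
    by_contra hpos
    refine hi ⟨hmeas.aestronglyMeasurable, ?_⟩
    refine lt_of_le_of_lt (lintegral_mono (g := fun τ =>
      ENNReal.ofReal (G.lagrangian H c (ξ τ) (deriv ξ τ) τ) +
        ENNReal.ofReal (-G.lagrangian H c (ξ τ) (deriv ξ τ) τ)) fun τ => ?_) ?_
    · rw [← ofReal_norm, Real.norm_eq_abs]
      rcases abs_cases (G.lagrangian H c (ξ τ) (deriv ξ τ) τ) with h | h
      · rw [h.1]; exact le_self_add
      · rw [h.1]; exact le_add_self
    · rw [lintegral_add_left' hmeas.ennreal_ofReal]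
      exact ENNReal.add_lt_top.2 ⟨lt_top_iff_ne_top.2 hpos, lt_top_iff_ne_top.2 hneg⟩
  rw [action, hpos]
  lift ∫⁻ τ in Icc a b, ENNReal.ofReal (-G.lagrangian H c (ξ τ) (deriv ξ τ) τ) to ℝ≥0 using hneg
    with m
  rfl

end Action

/-- `ξ` is a curve of finite action on `[0, t]` from `x₀` to `x`. -/
structure IsCompetitor (G : EmbeddedNetwork N E) (H : E → ℝ → ℝ → ℝ → ℝ)
    (c : EuclideanSpace ℝ (Fin N) → ℝ → ℝ) (x₀ x : G.Pt) (t : ℝ)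
    (ξ : ℝ → EuclideanSpace ℝ (Fin N)) : Prop where
  ac : AbsolutelyContinuousOnInterval ξ 0 t
  mapsTo : MapsTo ξ (Icc 0 t) G.carrier
  left : ξ 0 = x₀.1
  right : ξ t = x.1
  integrableOn : IntegrableOn (fun τ => G.lagrangian H c (ξ τ) (deriv ξ τ) τ) (Icc 0 t)

/-- The finite values of the functional whose infimum is the value function. -/
def costs (G : EmbeddedNetwork N E) (H : E → ℝ → ℝ → ℝ → ℝ)
    (c : EuclideanSpace ℝ (Fin N) → ℝ → ℝ) (u₀ : G.Pt → ℝ) (x : G.Pt) (t : ℝ) : Set ℝ :=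
  {v | ∃ x₀ ξ, G.IsCompetitor H c x₀ x t ξ ∧
    u₀ x₀ + ∫ τ in Icc 0 t, G.lagrangian H c (ξ τ) (deriv ξ τ) τ = v}

theorem valueFunction_eq_sInf [Countable E] (hH : G.IsHamiltonian H) (hc : G.IsFluxLimiter H c)
    {x : G.Pt} {t : ℝ} (ht : 0 ≤ t) (hne : (G.costs H c u₀ x t).Nonempty)
    (hbdd : BddBelow (G.costs H c u₀ x t)) :
    G.valueFunction H c u₀ x t = ((sInf (G.costs H c u₀ x t) : ℝ) : EReal) := by
  refine le_antisymm ?_ (le_iInf fun x₀ => ?_)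
  · by_contra hlt
    obtain ⟨r, hr1, hr2⟩ := EReal.lt_iff_exists_real_btwn.1 (not_le.1 hlt)
    obtain ⟨v, ⟨x₀, ξ, hξ, rfl⟩, hv⟩ := exists_lt_of_csInf_lt hne (EReal.coe_lt_coe_iff.1 hr1)
    refine absurd (hr2.trans_le ?_) (not_lt.2 (EReal.coe_le_coe_iff.2 hv.le))
    refine (iInf_le _ x₀).trans ?_
    rw [EReal.coe_add]
    refine add_le_add le_rfl ?_
    rw [← action_eq_integral hξ.integrableOn]
    exact iInf₂_le ξ ⟨hξ.ac, hξ.mapsTo, hξ.left, hξ.right⟩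
  · have key : ((sInf (G.costs H c u₀ x t) - u₀ x₀ : ℝ) : EReal) ≤
        G.minAction H c x₀ 0 x t := by
      refine le_iInf₂ fun ξ h => ?_
      obtain ⟨h1, h2, h3, h4⟩ := h
      by_cases hi : IntegrableOn (fun τ => G.lagrangian H c (ξ τ) (deriv ξ τ) τ) (Icc 0 t)
      · rw [action_eq_integral hi, EReal.coe_le_coe_iff, sub_le_iff_le_add']
        exact csInf_le hbdd ⟨x₀, ξ, ⟨h1, h2, h3, h4, hi⟩, rfl⟩
      · have hcont := h1.continuousOn
        rw [uIcc_of_le ht] at hcont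
        rw [action_eq_top hH hc le_rfl ht hcont h2 hi]
        exact le_top
    calc ((sInf (G.costs H c u₀ x t) : ℝ) : EReal)
        = (u₀ x₀ : EReal) + ((sInf (G.costs H c u₀ x t) - u₀ x₀ : ℝ) : EReal) := by
          rw [← EReal.coe_add]; congr 1; ring
      _ ≤ _ := add_le_add le_rfl key

/-! ### Coercivity of the cost. -/

section LowerBound

theorem exists_affine_modulus (hu₀ : UniformContinuous u₀) {ε : ℝ} (hε : 0 < ε) :
    ∃ A, 0 ≤ A ∧ ∀ x y : G.Pt, ∀ D, 0 ≤ D → edist x y ≤ ENNReal.ofReal D →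
      |u₀ x - u₀ y| ≤ ε + A * D := by
  obtain ⟨δ, hδ, h⟩ := EMetric.uniformContinuous_iff.1 hu₀ (ENNReal.ofReal (ε / 2)) (by simpa)
  obtain ⟨δ', hδ', hlt⟩ : ∃ δ' : ℝ, 0 < δ' ∧ ENNReal.ofReal δ' ≤ δ := by
    obtain ⟨p, hp, hp'⟩ := ENNReal.lt_iff_exists_nnreal_btwn.1 hδ
    exact ⟨p, by exact_mod_cast hp, by simpa using hp'.le⟩
  -- Oscillation `ε / 2` at scale `δ'`, chained over a distance less than `D + δ'`, sums to `((D +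
  -- δ') / δ' + 1) * (ε / 2) = ε + A D`.
  refine ⟨ε / (2 * δ'), by positivity, fun x y D hD hxy => ?_⟩
  have := G.abs_sub_le_of_edist_lt (f := u₀) (ε := ε / 2) hδ' (fun x y hxy => ?_)
    (hxy.trans_lt ((ENNReal.ofReal_lt_ofReal_iff (by linarith)).2 (lt_add_of_pos_right D hδ')))
  · refine this.trans (le_of_eq ?_)
    field_simp
    ring
  · have := h (hxy.trans_le hlt)
    rw [edist_dist, ENNReal.ofReal_lt_ofReal_iff (by linarith), Real.dist_eq] at this
    exact this.le

theorem exists_cost_lower_bound [Countable E] (hH : G.IsHamiltonian H)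
    (hc : G.IsFluxLimiter H c) (hu₀ : UniformContinuous u₀) {T : ℝ} (hT : 0 < T) {ε : ℝ}
    (hε : 0 < ε) :
    ∃ M, 0 ≤ M ∧ ∀ t ∈ Icc 0 T, ∀ x₀ x ξ, G.IsCompetitor H c x₀ x t ξ →
      u₀ x - ε - M * t + (∫ τ in (0 : ℝ)..t, ‖deriv ξ τ‖) ≤
        u₀ x₀ + ∫ τ in Icc 0 t, G.lagrangian H c (ξ τ) (deriv ξ τ) τ := by
  obtain ⟨A, hA, hA'⟩ := exists_affine_modulus hu₀ hε
  -- Of the slope `A + 1`, the part `A` pays for the variation of `u₀` between the endpoints, and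
  -- the remaining 1 leaves the length on the left-hand side.
  obtain ⟨M, hM, hM'⟩ := exists_norm_le_lagrangian hH hc hT (A := A + 1) (by positivity)
  refine ⟨M, hM, fun t ht x₀ x ξ hξ => ?_⟩
  have hcont := hξ.ac.continuousOn
  rw [uIcc_of_le ht.1] at hcont
  set I := ∫ τ in (0 : ℝ)..t, ‖deriv ξ τ‖ with hI
  have hI0 : 0 ≤ I := intervalIntegral.integral_nonneg ht.1 fun _ _ => norm_nonneg _
  have hdist : edist x₀ x ≤ ENNReal.ofReal I := by
    have h := (G.geodesicEDist_le_eVariationOn ht.1 hcont hξ.mapsTo).trans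
      (hξ.ac.eVariationOn_le ht.1)
    rwa [hξ.left, hξ.right] at h
  have h1 := (abs_le.1 (hA' x₀ x I hI0 hdist)).1
  have hint : IntegrableOn (fun τ => ‖deriv ξ τ‖) (Icc 0 t) :=
    (intervalIntegrable_iff_integrableOn_Icc_of_le ht.1).1 hξ.ac.intervalIntegrable_norm_deriv
  have h2 : ∫ τ in Icc 0 t, ((A + 1) * ‖deriv ξ τ‖ - M) ≤
      ∫ τ in Icc 0 t, G.lagrangian H c (ξ τ) (deriv ξ τ) τ := by
    refine integral_mono_ae ((hint.const_mul _).sub (integrable_const M)) hξ.integrableOn ?_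
    filter_upwards [ae_isAdmissibleVelocity ht.1 hξ.ac hξ.mapsTo,
      ae_restrict_mem measurableSet_Icc] with τ hτ hmem
    exact hM' _ _ hτ τ ⟨hmem.1, hmem.2.trans ht.2⟩
  rw [integral_sub (hint.const_mul _) (integrable_const M), integral_const_mul, setIntegral_const,
    integral_Icc_eq_integral_Ioc, ← intervalIntegral.integral_of_le ht.1, ← hI, smul_eq_mul,
    Real.volume_real_Icc_of_le ht.1] at h2
  linarith

end LowerBound

/-! ### Prolonging a curve by a walk of unit speed. -/

section Concatenation

theorem mem_costs_zero (x : G.Pt) : u₀ x ∈ G.costs H c u₀ x 0 := by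
  have h0 : volume.restrict (Icc (0 : ℝ) 0) = 0 := by simp
  refine ⟨x, fun _ => x.1, ⟨?_, fun _ _ => x.2, rfl, rfl, ?_⟩, ?_⟩
  · exact (LipschitzWith.const x.1).lipschitzOnWith.absolutelyContinuousOnInterval
  · rw [IntegrableOn, h0]; exact integrable_zero_measure
  · rw [h0]; simp

/-- A `D`-Lipschitz path on `[0,1]`, traversed in time `h ≥ D`, has speed at most 1, where the
Lagrangian is at most `B`. -/
theorem IsCompetitor.concat {x₀ x y : G.Pt} {t h D B : ℝ} {ξ : ℝ → EuclideanSpace ℝ (Fin N)}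
    [Countable E] (hH : G.IsHamiltonian H) (hc : G.IsFluxLimiter H c)
    (hξ : G.IsCompetitor H c x₀ x t ξ) (ht : 0 ≤ t) (hh : 0 < h) (hD : D ≤ h)
    (hxy : edist x y < ENNReal.ofReal D)
    (hB : ∀ x ∈ G.carrier, ∀ q, ‖q‖ ≤ 1 → ∀ τ ∈ Icc 0 (t + h), G.lagrangian H c x q τ ≤ B) :
    ∃ η, G.IsCompetitor H c x₀ y (t + h) η ∧
      ∫ τ in Icc 0 (t + h), G.lagrangian H c (η τ) (deriv η τ) τ ≤
        (∫ τ in Icc 0 t, G.lagrangian H c (ξ τ) (deriv ξ τ) τ) + B * h := by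
  obtain ⟨ζ, hL, hζm, hζ0, hζ1⟩ := G.exists_lipschitz_path hxy
  have hD0 : 0 < D := by
    by_contra hD
    rw [ENNReal.ofReal_of_nonpos (not_lt.1 hD)] at hxy
    exact not_lt_bot hxy
  have hth : t ≤ t + h := by linarith
  set ρ : ℝ → ℝ := fun τ => (τ - t) / h with hρ
  have hρm : MapsTo ρ (Icc t (t + h)) (Icc 0 1) := fun τ hτ =>
    ⟨div_nonneg (by linarith [hτ.1]) hh.le, div_le_one_of_le₀ (by linarith [hτ.2]) hh.le⟩
  have hζL : LipschitzOnWith 1 (ζ ∘ ρ) (Icc t (t + h)) := by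
    refine LipschitzOnWith.of_dist_le_mul fun p hp q hq => ?_
    refine (hL.dist_le_mul _ (hρm hp) _ (hρm hq)).trans ?_
    rw [Real.coe_toNNReal _ hD0.le, hρ, Real.dist_eq, ← sub_div, sub_sub_sub_cancel_right, abs_div,
      abs_of_pos hh, NNReal.coe_one, one_mul, Real.dist_eq, ← mul_div_assoc, div_le_iff₀ hh,
      mul_comm]
    exact mul_le_mul_of_nonneg_left hD (abs_nonneg _)
  set η : ℝ → EuclideanSpace ℝ (Fin N) := fun τ => if τ ≤ t then ξ τ else ζ (ρ τ) with hη
  have hη1 : ∀ τ, τ ≤ t → η τ = ξ τ := fun τ hτ => if_pos hτ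
  have hη2 : ∀ τ, t ≤ τ → η τ = ζ (ρ τ) := fun τ hτ => by
    rcases hτ.eq_or_lt with rfl | hτ
    · rw [hη1 _ le_rfl, hξ.right]; simp [hρ, hζ0]
    · exact if_neg (not_le.2 hτ)
  have hηm : MapsTo η (Icc 0 (t + h)) G.carrier := fun τ hτ => by
    rcases le_total τ t with h | h
    · rw [hη1 τ h]; exact hξ.mapsTo ⟨hτ.1, h⟩
    · rw [hη2 τ h]; exact hζm (hρm ⟨h, hτ.2⟩)
  -- An integrable bound for the speed on both sides of `t`, which makes the glued curve absolutely
  -- continuous.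
  set g : ℝ → ℝ := fun τ => if τ ≤ t then ‖deriv ξ τ‖ else 1 with hg
  have hg1 : IntervalIntegrable g volume 0 t :=
    hξ.ac.intervalIntegrable_norm_deriv.congr fun τ hτ => by
      rw [uIoc_of_le ht] at hτ
      exact (if_pos hτ.2).symm
  have hg2 : IntervalIntegrable g volume t (t + h) :=
    (intervalIntegrable_const (c := (1 : ℝ))).congr fun τ hτ => by
      rw [uIoc_of_le hth] at hτ
      exact (if_neg (not_le.2 hτ.1)).symm
  have hd1 : ∀ p ∈ Icc 0 t, ∀ q ∈ Icc 0 t, p ≤ q → dist (η p) (η q) ≤ ∫ τ in p..q, g τ := by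
    intro p hp q hq hpq
    rw [hη1 p hp.2, hη1 q hq.2, dist_comm, dist_eq_norm]
    have hsub : uIcc p q ⊆ uIcc 0 t :=
      uIcc_subset_uIcc (by rwa [uIcc_of_le ht]) (by rwa [uIcc_of_le ht])
    refine ((hξ.ac.mono hsub).norm_sub_le_integral hpq).trans (le_of_eq ?_)
    refine intervalIntegral.integral_congr fun τ hτ => ?_
    rw [uIcc_of_le hpq] at hτ
    exact (if_pos (hτ.2.trans hq.2)).symm
  have hd2 : ∀ p ∈ Icc t (t + h), ∀ q ∈ Icc t (t + h), p ≤ q →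
      dist (η p) (η q) ≤ ∫ τ in p..q, g τ := by
    intro p hp q hq hpq
    rw [hη2 p hp.1, hη2 q hq.1]
    refine (hζL.dist_le_mul p hp q hq).trans (le_of_eq ?_)
    have : ∫ τ in p..q, g τ = ∫ τ in p..q, (1 : ℝ) := by
      refine intervalIntegral.integral_congr_ae (ae_of_all _ fun τ hτ => ?_)
      rw [uIoc_of_le hpq] at hτ
      exact if_neg (not_le.2 (hp.1.trans_lt hτ.1))
    rw [this, NNReal.coe_one, one_mul, dist_comm, Real.dist_eq, abs_of_nonneg (sub_nonneg.2 hpq)]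
    simp
  have hac : AbsolutelyContinuousOnInterval η 0 (t + h) := by
    refine AbsolutelyContinuousOnInterval.of_dist_le (ht.trans hth) (hg1.trans hg2) ?_
    intro p hp q hq hpq
    rcases le_total q t with hqt | hqt
    · exact hd1 p ⟨hp.1, hpq.trans hqt⟩ q ⟨hq.1, hqt⟩ hpq
    rcases le_total t p with hpt | hpt
    · exact hd2 p ⟨hpt, hp.2⟩ q ⟨hqt, hq.2⟩ hpq
    · have i1 : IntervalIntegrable g volume p t := hg1.mono_set (by
        rw [uIcc_of_le hpt, uIcc_of_le ht]; exact Icc_subset_Icc_left hp.1)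
      have i2 : IntervalIntegrable g volume t q := hg2.mono_set (by
        rw [uIcc_of_le hqt, uIcc_of_le hth]; exact Icc_subset_Icc_right hq.2)
      rw [← intervalIntegral.integral_add_adjacent_intervals i1 i2]
      exact (dist_triangle _ (η t) _).trans (add_le_add
        (hd1 p ⟨hp.1, hpt⟩ t ⟨ht, le_rfl⟩ hpt) (hd2 t ⟨le_rfl, hth⟩ q ⟨hqt, hq.2⟩ hqt))
  have hηc := hac.continuousOn
  rw [uIcc_of_le (ht.trans hth)] at hηc
  have hmeas := aemeasurable_lagrangian hH hc le_rfl (ht.trans hth) hηc hηm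
  set F : ℝ → ℝ := fun τ => G.lagrangian H c (η τ) (deriv η τ) τ with hF
  have hne : ∀ᵐ τ : ℝ, τ ≠ t := Measure.ae_ne volume t
  have hF1 : F =ᵐ[volume.restrict (Icc 0 t)]
      fun τ => G.lagrangian H c (ξ τ) (deriv ξ τ) τ := by
    filter_upwards [ae_restrict_mem measurableSet_Icc, ae_restrict_of_ae hne] with τ hτ hτ'
    have hlt : τ < t := lt_of_le_of_ne hτ.2 hτ'
    have : η =ᶠ[𝓝 τ] ξ := by
      filter_upwards [Iio_mem_nhds hlt] with s hs using hη1 s (le_of_lt hs)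
    simp only [hF]
    rw [this.deriv_eq, this.eq_of_nhds]
  obtain ⟨M, hM, hM'⟩ := exists_le_lagrangian hH hc (T := t + h) (by linarith)
  have hne' : ∀ᵐ τ : ℝ, τ ≠ t + h := Measure.ae_ne volume (t + h)
  have hF2 : ∀ᵐ τ ∂volume.restrict (Ioc t (t + h)), -M ≤ F τ ∧ F τ ≤ B := by
    filter_upwards [ae_restrict_mem measurableSet_Ioc, ae_restrict_of_ae hne'] with τ hτ hτ'
    have hτI : τ ∈ Icc 0 (t + h) := ⟨ht.trans hτ.1.le, hτ.2⟩
    refine ⟨hM' _ (hηm hτI) _ τ hτI, hB _ (hηm hτI) _ ?_ τ hτI⟩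
    have hnhds : Icc t (t + h) ∈ 𝓝 τ := Icc_mem_nhds hτ.1 (lt_of_le_of_ne hτ.2 hτ')
    have := norm_deriv_le_of_lipschitzOn (f := η) (C := 1) hnhds
      (fun p hp q hq => by rw [hη2 p hp.1, hη2 q hq.1]; exact hζL hp hq)
    simpa using this
  have hF2i : IntegrableOn F (Ioc t (t + h)) := by
    refine Integrable.mono' (g := fun _ => max M B) (integrable_const _) ?_ ?_
    · refine (hmeas.mono_measure (Measure.restrict_mono ?_ le_rfl)).aestronglyMeasurable
      exact fun τ hτ => ⟨ht.trans hτ.1.le, hτ.2⟩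
    · filter_upwards [hF2] with τ hτ
      rw [Real.norm_eq_abs, abs_le]
      exact ⟨by linarith [le_max_left M B, hτ.1], hτ.2.trans (le_max_right _ _)⟩
  have hF1i : IntegrableOn F (Icc 0 t) := hξ.integrableOn.congr hF1.symm
  have hunion : Icc 0 (t + h) = Icc 0 t ∪ Ioc t (t + h) := (Icc_union_Ioc_eq_Icc ht hth).symm
  refine ⟨η, ⟨hac, hηm, by rw [hη1 0 ht, hξ.left], ?_, ?_⟩, ?_⟩
  · rw [hη2 _ hth]
    simp [hρ, hh.ne', hζ1]
  · rw [hunion]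
    exact hF1i.union hF2i
  · rw [hunion, setIntegral_union ?_ measurableSet_Ioc hF1i hF2i, integral_congr_ae hF1]
    · have : ∫ τ in Ioc t (t + h), F τ ≤ ∫ τ in Ioc t (t + h), B :=
        integral_mono_ae hF2i (integrable_const _) (hF2.mono fun τ hτ => hτ.2)
      rw [setIntegral_const, Real.volume_real_Ioc_of_le hth, smul_eq_mul] at this
      linarith
    · exact disjoint_left.2 fun τ h1 h2 => not_lt.2 h1.2 h2.1

theorem exists_cost_concat [Countable E] (hH : G.IsHamiltonian H) (hc : G.IsFluxLimiter H c)
    (u₀ : G.Pt → ℝ) {T : ℝ} (hT : 0 < T) :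
    ∃ B, 0 ≤ B ∧ ∀ x y : G.Pt, ∀ t h, 0 ≤ t → 0 < h → t + h ≤ T →
      edist x y < ENNReal.ofReal h → ∀ v ∈ G.costs H c u₀ x t,
        ∃ v' ∈ G.costs H c u₀ y (t + h), v' ≤ v + B * h := by
  obtain ⟨B, hB, hB'⟩ := exists_lagrangian_le hH hc hT 1
  refine ⟨B, hB, fun x y t h ht hh hth hxy v hv => ?_⟩
  obtain ⟨x₀, ξ, hξ, rfl⟩ := hv
  obtain ⟨η, hη, hle⟩ := hξ.concat hH hc ht hh le_rfl hxy fun x hx q hq τ hτ =>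
    hB' x hx q hq τ ⟨hτ.1, hτ.2.trans hth⟩
  exact ⟨_, ⟨x₀, η, hη, rfl⟩, by linarith⟩

end Concatenation

end EmbeddedNetwork

namespace EmbeddedNetwork

variable {N : ℕ} {E : Type*} {G : EmbeddedNetwork N E} {H : E → ℝ → ℝ → ℝ → ℝ}
  {c : EuclideanSpace ℝ (Fin N) → ℝ → ℝ} {u₀ : G.Pt → ℝ}

/-! ### Arriving earlier by accelerating on slow times. -/

section SpeedUp

/-- A curve of length at most `A` spends a time of at least `t / 2` with speed below `2 A / t`. -/
theorem exists_slow_set {ξ : ℝ → EuclideanSpace ℝ (Fin N)} {t A r : ℝ} (ht : 0 ≤ t) (hr : 0 < r)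
    (hi : IntervalIntegrable (fun τ => ‖deriv ξ τ‖) volume 0 t)
    (hA : ∫ τ in (0 : ℝ)..t, ‖deriv ξ τ‖ ≤ A) :
    ∃ S : Set ℝ, MeasurableSet S ∧ S ⊆ Ioc 0 t ∧ (∀ τ ∈ S, ‖deriv ξ τ‖ ≤ r) ∧
      t - A / r ≤ volume.real S := by
  have hm : Measurable fun τ => ‖deriv ξ τ‖ := (measurable_deriv ξ).norm
  have hS : MeasurableSet {τ | r ≤ ‖deriv ξ τ‖} := measurableSet_le measurable_const hm
  refine ⟨Ioc 0 t \ {τ | r ≤ ‖deriv ξ τ‖}, measurableSet_Ioc.diff hS, sdiff_subset,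
    fun τ hτ => le_of_lt (not_le.1 hτ.2), ?_⟩
  have h1 := mul_meas_ge_le_integral_of_nonneg (μ := volume.restrict (Ioc 0 t))
    (f := fun τ => ‖deriv ξ τ‖) (ae_of_all _ fun _ => norm_nonneg _)
    ((intervalIntegrable_iff_integrableOn_Ioc_of_le ht).1 hi) r
  rw [← intervalIntegral.integral_of_le ht, measureReal_restrict_apply hS] at h1
  have h2 := measureReal_inter_add_sdiff (μ := volume) (s := Ioc 0 t) hS (by simp)
  rw [Real.volume_real_Ioc_of_le ht, inter_comm] at h2
  have h3 : volume.real ({τ | r ≤ ‖deriv ξ τ‖} ∩ Ioc 0 t) ≤ A / r := by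
    rw [le_div_iff₀ hr]
    linarith
  linarith

/-- The curve is accelerated by the factor `1/(1-κ)` on its slow times `S` only, so the cost of
acceleration involves only speeds up to `r`. Every point is reached at most `δ` too early; this
error is linear in the speed, so its integral is bounded through the length. -/
theorem IsCompetitor.speed_up [Countable E] (hH : G.IsHamiltonian H) (hc : G.IsFluxLimiter H c)
    {x₀ x : G.Pt} {t T A r δ ε C₁ C₂ : ℝ} {ξ : ℝ → EuclideanSpace ℝ (Fin N)}
    (hξ : G.IsCompetitor H c x₀ x t ξ) (ht : 0 < t) (htT : t ≤ T)
    (hA : ∫ τ in (0 : ℝ)..t, ‖deriv ξ τ‖ ≤ A) (hr : 0 < r) (hAr : A / r ≤ t / 2)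
    (hδ : 0 ≤ δ) (hδt : δ ≤ t / 4) (hδε : δ < ε) (hC₂ : 0 ≤ C₂)
    (h₁ : ∀ x ∈ G.carrier, ∀ q, ‖q‖ ≤ r → ∀ τ ∈ Icc 0 T, ∀ κ ∈ Icc 0 (1 / 2 : ℝ),
      (1 - κ) * G.lagrangian H c x ((1 - κ)⁻¹ • q) τ ≤ G.lagrangian H c x q τ + κ * C₁)
    (h₂ : ∀ x ∈ G.carrier, ∀ q, ∀ t₁ ∈ Icc 0 T, ∀ t₂ ∈ Icc 0 T, |t₁ - t₂| < ε →
      G.lagrangian H c x q t₁ - G.lagrangian H c x q t₂ ≤ C₂ * (1 + ‖q‖) * |t₁ - t₂|) :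
    ∃ η, G.IsCompetitor H c x₀ x (t - δ) η ∧
      ∫ τ in Icc 0 (t - δ), G.lagrangian H c (η τ) (deriv η τ) τ ≤
        (∫ τ in Icc 0 t, G.lagrangian H c (ξ τ) (deriv ξ τ) τ) +
          (C₁ + C₂ * (t + A)) * δ := by
  have hint := hξ.ac.intervalIntegrable_norm_deriv
  obtain ⟨S, hS, hSt, hSr, hSm⟩ := exists_slow_set ht.le hr hint hA
  set m := volume.real S with hm
  have hm0 : t / 2 ≤ m := by linarith
  have hmpos : 0 < m := by linarith
  -- With this `κ` the saved time `κ m` is exactly `δ`; the bounds `δ ≤ t / 4` and `m ≥ t / 2` give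
  -- `κ ≤ 1/2`.
  set κ := δ / m with hκ
  have hκm : κ * m = δ := div_mul_cancel₀ _ hmpos.ne'
  have hκI : κ ∈ Icc 0 (1 / 2 : ℝ) := by
    refine ⟨by positivity, ?_⟩
    rw [hκ, div_le_iff₀ hmpos]
    linarith
  set w : ℝ → ℝ := fun τ => 1 - S.indicator (fun _ => κ) τ with hw
  have hwS : ∀ τ ∈ S, w τ = 1 - κ := fun τ hτ => by rw [hw]; simp only [indicator_of_mem hτ]
  have hwS' : ∀ τ ∉ S, w τ = 1 := fun τ hτ => by
    rw [hw]; simp only [indicator_of_notMem hτ, sub_zero]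
  have hwm : Measurable w := measurable_const.sub (measurable_const.indicator hS)
  have hw1 : ∀ τ, 1 / 2 ≤ w τ := fun τ => by
    by_cases h : τ ∈ S
    · rw [hwS τ h]; linarith [hκI.2]
    · rw [hwS' τ h]; norm_num
  have hw2 : ∀ τ, w τ ≤ 1 := fun τ => by
    by_cases h : τ ∈ S
    · rw [hwS τ h]; linarith [hκI.1]
    · rw [hwS' τ h]
  obtain ⟨ψ, φ, hψ, hψm, hφm, hφL, hφψ, hψφ, hder, hcov⟩ := exists_time_change hwm hw1 hw2
  have hψ0 : ψ 0 = 0 := by rw [hψ, intervalIntegral.integral_same]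
  have hSi : IntegrableOn (S.indicator fun _ => κ) (Ioc 0 t) :=
    (integrable_const κ).indicator hS
  have hψt : ψ t = t - δ := by
    have h1 : ∫ τ in Ioc 0 t, S.indicator (fun _ => κ) τ = δ := by
      rw [setIntegral_indicator hS, inter_eq_self_of_subset_right hSt, setIntegral_const,
        smul_eq_mul, mul_comm, hκm]
    rw [hψ, intervalIntegral.integral_of_le ht.le, hw, integral_sub (integrable_const _) hSi, h1,
      setIntegral_const, Real.volume_real_Ioc_of_le ht.le]
    simp
  have htδ : 0 ≤ t - δ := by linarith
  have hwint : ∀ a b, IntervalIntegrable w volume a b := fun a b => by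
    refine (intervalIntegrable_const (c := (1 : ℝ))).mono_fun hwm.aestronglyMeasurable
      (ae_of_all _ fun τ => ?_)
    change ‖w τ‖ ≤ ‖(1 : ℝ)‖
    rw [norm_one, Real.norm_of_nonneg (by linarith [hw1 τ])]
    exact hw2 τ
  have hψup : ∀ a b, a ≤ b → ψ b - ψ a ≤ b - a := fun a b hab => by
    rw [hψ, hψ, intervalIntegral.integral_interval_sub_left (hwint _ _) (hwint _ _)]
    refine (intervalIntegral.integral_mono_on hab (hwint a b)
      (intervalIntegrable_const (c := (1 : ℝ))) fun τ _ => hw2 τ).trans (le_of_eq ?_)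
    simp
  have hψle : ∀ τ ∈ Icc 0 t, ψ τ ≤ τ := fun τ hτ => by
    have := hψup 0 τ hτ.1
    rw [hψ0] at this
    linarith
  have hψge : ∀ τ ∈ Icc 0 t, τ - δ ≤ ψ τ := fun τ hτ => by
    have := hψup τ t hτ.2
    rw [hψt] at this
    linarith
  have hψnn : ∀ τ ∈ Icc 0 t, 0 ≤ ψ τ := fun τ hτ => hψ0 ▸ hψm hτ.1
  have hφmaps : MapsTo φ (Icc 0 (t - δ)) (Icc 0 t) := fun σ hσ => by
    have h1 := hφm hσ.1
    have h2 := hφm hσ.2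
    rw [← hψ0, hφψ] at h1
    rw [← hψt, hφψ] at h2
    exact ⟨h1, h2⟩
  set η := ξ ∘ φ with hη
  have hηψ : ∀ τ, η (ψ τ) = ξ τ := fun τ => congrArg ξ (hφψ τ)
  have hηm : MapsTo η (Icc 0 (t - δ)) G.carrier := hξ.mapsTo.comp hφmaps
  have hηac : AbsolutelyContinuousOnInterval η 0 (t - δ) :=
    hξ.ac.comp_right hφL hφm (by rwa [uIcc_of_le htδ, uIcc_of_le ht.le])
  have hηc := hηac.continuousOn
  rw [uIcc_of_le htδ] at hηc
  have hηd : ∀ᵐ τ ∂volume.restrict (Icc 0 t), deriv η (ψ τ) = (w τ)⁻¹ • deriv ξ τ := by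
    filter_upwards [ae_restrict_of_ae hder, ae_restrict_of_ae hξ.ac.ae_differentiableAt_euclidean,
      ae_restrict_mem measurableSet_Icc] with τ h1 h2 hτ
    rw [uIcc_of_le ht.le] at h2
    have h3 := (h2 hτ).hasDerivAt
    rw [← hφψ τ] at h3
    have h4 := h3.scomp (ψ τ) h1.2
    rw [hφψ] at h4
    exact h4.deriv
  set F : ℝ → ℝ := fun σ => G.lagrangian H c (η σ) (deriv η σ) σ with hF
  have hFm : AEMeasurable F (volume.restrict (Icc 0 (ψ t))) := by
    rw [hψt]
    exact aemeasurable_lagrangian hH hc le_rfl htδ hηc hηm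
  -- Almost everywhere measurability of `F` passes to `F ∘ ψ` because preimages of null sets under
  -- `ψ` are images under the Lipschitz map `φ`, hence null.
  have hqmp : Measure.QuasiMeasurePreserving ψ (volume.restrict (Icc 0 t))
      (volume.restrict (Icc 0 (ψ t))) := by
    have : Measure.QuasiMeasurePreserving ψ volume volume := by
      refine ⟨hψm.measurable, Measure.AbsolutelyContinuous.mk fun s hs h0 => ?_⟩
      rw [Measure.map_apply hψm.measurable hs]
      have himg : ψ ⁻¹' s ⊆ φ '' s := fun τ hτ => ⟨ψ τ, hτ, hφψ τ⟩
      have h := hφL.hausdorffMeasure_image_le (d := 1) zero_le_one s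
      rw [hausdorffMeasure_real, h0, mul_zero] at h
      exact measure_mono_null himg (le_antisymm h bot_le)
    exact this.restrict fun τ hτ => ⟨hψnn τ hτ, hψm hτ.2⟩
  have hgm : AEStronglyMeasurable (fun τ => w τ * F (ψ τ)) (volume.restrict (Icc 0 t)) :=
    (hwm.aemeasurable.mul (hFm.comp_quasiMeasurePreserving hqmp)).aestronglyMeasurable
  have hnorm : IntegrableOn (fun τ => ‖deriv ξ τ‖) (Icc 0 t) :=
    (intervalIntegrable_iff_integrableOn_Icc_of_le ht.le).1 hint
  -- The majorant of the transformed integrand: the original Lagrangian, the cost of acceleration on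
  -- `S`, and the cost of the time shift.
  set g : ℝ → ℝ := fun τ => G.lagrangian H c (ξ τ) (deriv ξ τ) τ +
    (S.indicator (fun _ => κ * C₁) τ + C₂ * δ * (1 + ‖deriv ξ τ‖)) with hg
  have hgi1 : IntegrableOn (S.indicator fun _ => κ * C₁) (Icc 0 t) :=
    (integrable_const _).indicator hS
  have hgi2 : IntegrableOn (fun τ => C₂ * δ * (1 + ‖deriv ξ τ‖)) (Icc 0 t) :=
    ((integrable_const (1 : ℝ)).add hnorm).const_mul _
  have hgi : IntegrableOn g (Icc 0 t) := hξ.integrableOn.add (hgi1.add hgi2)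
  obtain ⟨M, hM, hM'⟩ := exists_le_lagrangian hH hc (ht.trans_le htT)
  have hbounds : ∀ᵐ τ ∂volume.restrict (Icc 0 t), -M ≤ w τ * F (ψ τ) ∧ w τ * F (ψ τ) ≤ g τ := by
    filter_upwards [hηd, ae_restrict_mem measurableSet_Icc] with τ hd hτ
    have hwpos : 0 < w τ := by linarith [hw1 τ]
    have hx := hξ.mapsTo hτ
    have hτT : τ ∈ Icc 0 T := ⟨hτ.1, hτ.2.trans htT⟩
    have hψT : ψ τ ∈ Icc 0 T := ⟨hψnn τ hτ, (hψle τ hτ).trans hτT.2⟩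
    simp only [hF, hηψ, hd]
    constructor
    · have h3 := mul_le_mul_of_nonneg_left (hM' _ hx ((w τ)⁻¹ • deriv ξ τ) _ hψT) hwpos.le
      have h4 : w τ * M ≤ M := mul_le_of_le_one_left hM (hw2 τ)
      linarith
    · have habs : |ψ τ - τ| ≤ δ := by
        rw [abs_le]; constructor <;> linarith [hψle τ hτ, hψge τ hτ]
      have h3 := h₂ _ hx ((w τ)⁻¹ • deriv ξ τ) _ hψT _ hτT (habs.trans_lt hδε)
      -- The Jacobian `w` cancels the increase of the speed.
      have h4 : w τ * (1 + ‖(w τ)⁻¹ • deriv ξ τ‖) ≤ 1 + ‖deriv ξ τ‖ := by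
        rw [norm_smul, Real.norm_of_nonneg (inv_nonneg.2 hwpos.le), mul_add, ← mul_assoc,
          mul_inv_cancel₀ hwpos.ne']
        linarith [hw2 τ]
      have h5 : w τ * (C₂ * (1 + ‖(w τ)⁻¹ • deriv ξ τ‖) * |ψ τ - τ|) ≤
          C₂ * δ * (1 + ‖deriv ξ τ‖) := by
        calc w τ * (C₂ * (1 + ‖(w τ)⁻¹ • deriv ξ τ‖) * |ψ τ - τ|)
            = C₂ * (w τ * (1 + ‖(w τ)⁻¹ • deriv ξ τ‖)) * |ψ τ - τ| := by ring
          _ ≤ C₂ * (1 + ‖deriv ξ τ‖) * δ := by gcongr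
          _ = C₂ * δ * (1 + ‖deriv ξ τ‖) := by ring
      have h6 : w τ * G.lagrangian H c (ξ τ) ((w τ)⁻¹ • deriv ξ τ) τ ≤
          G.lagrangian H c (ξ τ) (deriv ξ τ) τ + S.indicator (fun _ => κ * C₁) τ := by
        by_cases h : τ ∈ S
        · rw [hwS τ h, indicator_of_mem h]
          exact h₁ _ hx _ (hSr τ h) τ hτT κ hκI
        · rw [hwS' τ h, indicator_of_notMem h]
          simp
      have h7 := mul_le_mul_of_nonneg_left h3 hwpos.le
      simp only [hg]
      linarith
  have hi : IntegrableOn (fun τ => w τ * F (ψ τ)) (Icc 0 t) := by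
    refine Integrable.mono' (g := fun τ => |g τ| + M) (hgi.abs.add (integrable_const M)) hgm ?_
    filter_upwards [hbounds] with τ hτ
    rw [Real.norm_eq_abs, abs_le]
    constructor <;> linarith [le_abs_self (g τ), abs_nonneg (g τ)]
  have hFi : IntegrableOn F (Icc 0 (t - δ)) := by
    rw [← hψt]
    exact (hcov F t).1.2 hi
  refine ⟨η, ⟨hηac, hηm, ?_, ?_, hFi⟩, ?_⟩
  · rw [← hψ0, hηψ, hξ.left]
  · rw [← hψt, hηψ, hξ.right]
  · have h1 : ∫ σ in Icc 0 (t - δ), F σ ≤ ∫ τ in Icc 0 t, g τ := by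
      rw [← hψt, (hcov F t).2]
      exact integral_mono_ae hi hgi (hbounds.mono fun τ h => h.2)
    have h2 : ∫ τ in Icc 0 t, g τ = (∫ τ in Icc 0 t, G.lagrangian H c (ξ τ) (deriv ξ τ) τ) +
        (C₁ * δ + C₂ * δ * (t + ∫ τ in (0 : ℝ)..t, ‖deriv ξ τ‖)) := by
      have hSt' : S ⊆ Icc 0 t := hSt.trans Ioc_subset_Icc_self
      have e1 : ∫ τ in Icc 0 t, S.indicator (fun _ => κ * C₁) τ = C₁ * δ := by
        rw [setIntegral_indicator hS, inter_eq_self_of_subset_right hSt', setIntegral_const,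
          smul_eq_mul, ← hκm, ← hm]
        ring
      have e2 : ∫ τ in Icc 0 t, C₂ * δ * (1 + ‖deriv ξ τ‖) =
          C₂ * δ * (t + ∫ τ in (0 : ℝ)..t, ‖deriv ξ τ‖) := by
        rw [integral_const_mul, integral_add (integrable_const _) hnorm, setIntegral_const,
          Real.volume_real_Icc_of_le ht.le, intervalIntegral.integral_of_le ht.le,
          integral_Icc_eq_integral_Ioc]
        simp
      rw [← e1, ← e2, ← integral_add hgi1 hgi2]
      exact integral_add hξ.integrableOn (hgi1.add hgi2)
    have h3 := mul_le_mul_of_nonneg_left hA (mul_nonneg hC₂ hδ)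
    linarith

theorem exists_cost_speed_up [Countable E] (hH : G.IsHamiltonian H) (hc : G.IsFluxLimiter H c)
    (hu₀ : UniformContinuous u₀) {t₀ T : ℝ} (ht₀ : 0 < t₀) (hT : t₀ ≤ T) (K : ℝ) :
    ∃ C δ₀ : ℝ, 0 ≤ C ∧ 0 < δ₀ ∧ ∀ x : G.Pt, ∀ t ∈ Icc t₀ T, ∀ δ ∈ Icc 0 δ₀,
      ∀ v ∈ G.costs H c u₀ x t, v ≤ u₀ x + K →
        ∃ v' ∈ G.costs H c u₀ x (t - δ), v' ≤ v + C * δ := by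
  have hTpos : 0 < T := ht₀.trans_le hT
  obtain ⟨M, hM, hM'⟩ := exists_cost_lower_bound hH hc hu₀ hTpos one_pos
  -- The coercivity estimate with `ε = 1` bounds by `A` the length of every curve of cost at most
  -- `u₀ x + K`. The choice of `r` below makes its fast times occupy at most `t₀ / 2`.
  set A := |K| + 1 + M * T with hA
  have hApos : 0 < A := by positivity
  set r := 2 * A / t₀ with hr
  have hrpos : 0 < r := by positivity
  have hAr : A / r = t₀ / 2 := by rw [hr]; field_simp
  obtain ⟨C₁, hC₁, h₁⟩ := exists_lagrangian_speed_up hH hc hTpos r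
  obtain ⟨C₂, ε, hC₂, hε, h₂⟩ := exists_lagrangian_time hH hc hTpos
  refine ⟨C₁ + C₂ * (T + A), min (t₀ / 4) (ε / 2), by positivity, by positivity, ?_⟩
  rintro x t ht δ hδ v ⟨x₀, ξ, hξ, rfl⟩ hv
  have htpos : 0 < t := ht₀.trans_le ht.1
  have hlen := hM' t ⟨htpos.le, ht.2⟩ x₀ x ξ hξ
  have hMt := mul_le_mul_of_nonneg_left ht.2 hM
  have hδ1 := hδ.2.trans (min_le_left _ _)
  have hδ2 := hδ.2.trans (min_le_right _ _)
  obtain ⟨η, hη, hle⟩ := hξ.speed_up hH hc htpos ht.2 (A := A) (r := r) (δ := δ)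
    (by linarith [le_abs_self K]) hrpos (by linarith [ht.1]) hδ.1 (by linarith [ht.1])
    (by linarith) hC₂ h₁ h₂
  refine ⟨_, ⟨x₀, η, hη, rfl⟩, ?_⟩
  have h3 : (C₁ + C₂ * (t + A)) * δ ≤ (C₁ + C₂ * (T + A)) * δ := by
    have := hδ.1
    gcongr
    exact ht.2
  linarith

end SpeedUp

end EmbeddedNetwork

namespace EmbeddedNetwork

variable {N : ℕ} {E : Type*} [Countable E] {G : EmbeddedNetwork N E} {H : E → ℝ → ℝ → ℝ → ℝ}
  {c : EuclideanSpace ℝ (Fin N) → ℝ → ℝ} {u₀ : G.Pt → ℝ}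

/-! ### Passing to the infimum of the costs. -/

section Infimum

variable {T : ℝ}

theorem bddBelow_costs (hH : G.IsHamiltonian H) (hc : G.IsFluxLimiter H c)
    (hu₀ : UniformContinuous u₀) {t : ℝ} (ht : 0 ≤ t) (x : G.Pt) :
    BddBelow (G.costs H c u₀ x t) := by
  obtain ⟨M, -, hM⟩ := exists_cost_lower_bound hH hc hu₀ (T := t + 1) (by linarith) one_pos
  refine ⟨u₀ x - 1 - M * t, ?_⟩
  rintro _ ⟨x₀, ξ, hξ, rfl⟩
  have h1 := hM t ⟨ht, by linarith⟩ x₀ x ξ hξ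
  have h2 : 0 ≤ ∫ τ in (0 : ℝ)..t, ‖deriv ξ τ‖ :=
    intervalIntegral.integral_nonneg ht fun _ _ => norm_nonneg _
  linarith

theorem exists_cost_le (hH : G.IsHamiltonian H) (hc : G.IsFluxLimiter H c) (u₀ : G.Pt → ℝ)
    (hT : 0 < T) :
    ∃ B, 0 ≤ B ∧ ∀ x : G.Pt, ∀ t ∈ Icc 0 T, ∃ v ∈ G.costs H c u₀ x t, v ≤ u₀ x + B * t := by
  obtain ⟨B, hB, h⟩ := exists_cost_concat hH hc u₀ hT
  refine ⟨B, hB, fun x t ht => ?_⟩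
  rcases ht.1.eq_or_lt with rfl | h0
  · exact ⟨u₀ x, mem_costs_zero x, by simp⟩
  · have := h x x 0 t le_rfl h0 (by simpa using ht.2) (by simpa using h0) _ (mem_costs_zero x)
    rwa [zero_add] at this

theorem nonempty_costs (hH : G.IsHamiltonian H) (hc : G.IsFluxLimiter H c) (u₀ : G.Pt → ℝ)
    {t : ℝ} (ht : 0 ≤ t) (x : G.Pt) : (G.costs H c u₀ x t).Nonempty := by
  obtain ⟨B, -, h⟩ := exists_cost_le hH hc u₀ (T := t + 1) (by linarith)
  obtain ⟨v, hv, -⟩ := h x t ⟨ht, by linarith⟩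
  exact ⟨v, hv⟩

theorem exists_sInf_costs_le (hH : G.IsHamiltonian H) (hc : G.IsFluxLimiter H c)
    (hu₀ : UniformContinuous u₀) (hT : 0 < T) :
    ∃ B, 0 ≤ B ∧ ∀ x : G.Pt, ∀ t ∈ Icc 0 T, sInf (G.costs H c u₀ x t) ≤ u₀ x + B * t := by
  obtain ⟨B, hB, h⟩ := exists_cost_le hH hc u₀ hT
  refine ⟨B, hB, fun x t ht => ?_⟩
  obtain ⟨v, hv, hle⟩ := h x t ht
  exact (csInf_le (bddBelow_costs hH hc hu₀ ht.1 x) hv).trans hle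

theorem exists_le_sInf_costs (hH : G.IsHamiltonian H) (hc : G.IsFluxLimiter H c)
    (hu₀ : UniformContinuous u₀) (hT : 0 < T) {ε : ℝ} (hε : 0 < ε) :
    ∃ M, 0 ≤ M ∧ ∀ x : G.Pt, ∀ t ∈ Icc 0 T,
      u₀ x - ε - M * t ≤ sInf (G.costs H c u₀ x t) := by
  obtain ⟨M, hM, h⟩ := exists_cost_lower_bound hH hc hu₀ hT hε
  refine ⟨M, hM, fun x t ht => le_csInf (nonempty_costs hH hc u₀ ht.1 x) ?_⟩
  rintro _ ⟨x₀, ξ, hξ, rfl⟩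
  have h1 := h t ht x₀ x ξ hξ
  have h2 : 0 ≤ ∫ τ in (0 : ℝ)..t, ‖deriv ξ τ‖ :=
    intervalIntegral.integral_nonneg ht.1 fun _ _ => norm_nonneg _
  linarith

theorem exists_sInf_costs_concat (hH : G.IsHamiltonian H) (hc : G.IsFluxLimiter H c)
    (hu₀ : UniformContinuous u₀) (hT : 0 < T) :
    ∃ B, 0 ≤ B ∧ ∀ x y : G.Pt, ∀ t h, 0 ≤ t → 0 < h → t + h ≤ T →
      edist x y < ENNReal.ofReal h →
        sInf (G.costs H c u₀ y (t + h)) ≤ sInf (G.costs H c u₀ x t) + B * h := by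
  obtain ⟨B, hB, H'⟩ := exists_cost_concat hH hc u₀ hT
  refine ⟨B, hB, fun x y t h ht hh hth hxy => ?_⟩
  rw [← sub_le_iff_le_add]
  refine le_csInf (nonempty_costs hH hc u₀ ht x) fun v hv => ?_
  obtain ⟨v', hv', hle⟩ := H' x y t h ht hh hth hxy v hv
  have := csInf_le (bddBelow_costs hH hc hu₀ (by linarith) y) hv'
  linarith

theorem exists_sInf_costs_speed_up (hH : G.IsHamiltonian H) (hc : G.IsFluxLimiter H c)
    (hu₀ : UniformContinuous u₀) {t₀ : ℝ} (ht₀ : 0 < t₀) (hT : t₀ ≤ T) :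
    ∃ C δ₀ : ℝ, 0 ≤ C ∧ 0 < δ₀ ∧ δ₀ ≤ t₀ ∧ ∀ x : G.Pt, ∀ t ∈ Icc t₀ T, ∀ δ ∈ Icc 0 δ₀,
      sInf (G.costs H c u₀ x (t - δ)) ≤ sInf (G.costs H c u₀ x t) + C * δ := by
  have hTpos : 0 < T := ht₀.trans_le hT
  obtain ⟨B, hB, hB'⟩ := exists_sInf_costs_le hH hc hu₀ hTpos
  -- The level `B * T + 1` above `u₀` contains all curves optimal up to 1, uniformly in the point
  -- and the time.
  obtain ⟨C, δ₀, hC, hδ₀, h⟩ := exists_cost_speed_up hH hc hu₀ ht₀ hT (B * T + 1)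
  refine ⟨C, min δ₀ t₀, hC, lt_min hδ₀ ht₀, min_le_right _ _, fun x t ht δ hδ => ?_⟩
  have htpos : 0 < t := ht₀.trans_le ht.1
  have hδt : δ ≤ t := (hδ.2.trans (min_le_right _ _)).trans ht.1
  refine le_of_forall_pos_le_add fun ε hε => ?_
  obtain ⟨v, hv, hlt⟩ := exists_lt_of_csInf_lt (nonempty_costs hH hc u₀ htpos.le x)
    (lt_add_of_pos_right (sInf (G.costs H c u₀ x t)) (lt_min hε one_pos))
  have h1 := hB' x t ⟨htpos.le, ht.2⟩
  have h2 := mul_le_mul_of_nonneg_left ht.2 hB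
  obtain ⟨v', hv', hle⟩ := h x t ht δ ⟨hδ.1, hδ.2.trans (min_le_left _ _)⟩ v hv
    (by linarith [min_le_right ε 1])
  have h3 := csInf_le (bddBelow_costs hH hc hu₀ (by linarith) x) hv'
  linarith [min_le_left ε 1]

end Infimum

/-! ### Lipschitz and uniform continuity. -/

section Regularity

/-- Reach `x` at time `t - δ` by acceleration, then walk to `y` in the time `δ` gained: `u(y,t) ≤
u(x,t-δ) + B δ ≤ u(x,t) + (B + C) δ`. Larger distances are handled by chaining at scale `δ₀`, which
at most doubles the constant. -/
theorem exists_sInf_costs_lipschitz_space (hH : G.IsHamiltonian H) (hc : G.IsFluxLimiter H c)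
    (hu₀ : UniformContinuous u₀) {t₀ T : ℝ} (ht₀ : 0 < t₀) (hT : t₀ ≤ T) :
    ∃ K, 0 ≤ K ∧ ∀ t ∈ Icc t₀ T, ∀ x y : G.Pt, ∀ D, 0 ≤ D → edist x y ≤ ENNReal.ofReal D →
      |sInf (G.costs H c u₀ x t) - sInf (G.costs H c u₀ y t)| ≤ K * D := by
  obtain ⟨B, hB, hB'⟩ := exists_sInf_costs_concat hH hc hu₀ (ht₀.trans_le hT)
  obtain ⟨C, δ₀, hC, hδ₀, hδt, hC'⟩ := exists_sInf_costs_speed_up hH hc hu₀ ht₀ hT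
  refine ⟨2 * (B + C), by positivity, fun t ht => ?_⟩
  set f : G.Pt → ℝ := fun x => sInf (G.costs H c u₀ x t)
  have hloc : ∀ δ, 0 < δ → δ ≤ δ₀ → ∀ x y : G.Pt, edist x y < ENNReal.ofReal δ →
      |f x - f y| ≤ (B + C) * δ := by
    intro δ hδ hδ' x y hxy
    have key : ∀ x y : G.Pt, edist x y < ENNReal.ofReal δ → f y ≤ f x + (B + C) * δ := by
      intro x y hxy
      have h1 := hC' x t ht δ ⟨hδ.le, hδ'⟩
      have h2 := hB' x y (t - δ) δ (by linarith [ht.1]) hδ (by linarith [ht.2]) hxy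
      rw [sub_add_cancel] at h2
      change sInf _ ≤ sInf _ + _
      linarith
    have h1 := key x y hxy
    have h2 := key y x (by rwa [edist_comm])
    rw [abs_le]
    constructor <;> linarith
  have hglob : ∀ x y : G.Pt, ∀ D, 0 < D → edist x y < ENNReal.ofReal D →
      |f x - f y| ≤ 2 * (B + C) * D := by
    intro x y D hD hxy
    have hBC : 0 ≤ B + C := by positivity
    rcases le_total D δ₀ with h | h
    · have h1 := hloc D hD h x y hxy
      have h2 := mul_nonneg hBC hD.le
      linarith
    · have h1 := G.abs_sub_le_of_edist_lt hδ₀ (hloc δ₀ hδ₀ le_rfl) hxy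
      have h2 : (D / δ₀ + 1) * ((B + C) * δ₀) = (B + C) * (D + δ₀) := by field_simp
      have h3 := mul_le_mul_of_nonneg_left h hBC
      linarith
  intro x y D hD hxy
  -- Enlarging `D` slightly turns the non-strict bound on the distance into a strict one, including
  -- when `D = 0`.
  refine le_of_forall_pos_le_add fun ε hε => ?_
  have hK : 0 < 2 * (B + C) + 1 := by positivity
  have h1 := hglob x y (D + ε / (2 * (B + C) + 1)) (by positivity)
    (hxy.trans_lt ((ENNReal.ofReal_lt_ofReal_iff (by positivity)).2
      (lt_add_of_pos_right _ (by positivity))))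
  have h2 : 2 * (B + C) * (ε / (2 * (B + C) + 1)) ≤ ε := by
    rw [← mul_div_assoc, div_le_iff₀ hK]
    linarith
  linarith

/-- Concatenation with `y = x` bounds the increase in time, acceleration the decrease over steps up
to `δ₀`. For longer steps both values lie within a fixed distance of the same `u₀ x`, and `Q` is
that distance divided by `δ₀`. -/
theorem exists_sInf_costs_lipschitz_time (hH : G.IsHamiltonian H) (hc : G.IsFluxLimiter H c)
    (hu₀ : UniformContinuous u₀) {t₀ T : ℝ} (ht₀ : 0 < t₀) (hT : t₀ ≤ T) :
    ∃ K, 0 ≤ K ∧ ∀ x : G.Pt, ∀ s ∈ Icc t₀ T, ∀ t ∈ Icc t₀ T,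
      |sInf (G.costs H c u₀ x s) - sInf (G.costs H c u₀ x t)| ≤ K * |s - t| := by
  have hTpos : 0 < T := ht₀.trans_le hT
  obtain ⟨B, hB, hB'⟩ := exists_sInf_costs_concat hH hc hu₀ hTpos
  obtain ⟨B₁, hB₁, hB₁'⟩ := exists_sInf_costs_le hH hc hu₀ hTpos
  obtain ⟨M, hM, hM'⟩ := exists_le_sInf_costs hH hc hu₀ hTpos one_pos
  obtain ⟨C, δ₀, hC, hδ₀, -, hC'⟩ := exists_sInf_costs_speed_up hH hc hu₀ ht₀ hT
  set Q := (B₁ * T + 1 + M * T) / δ₀ with hQ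
  have hQ0 : 0 ≤ Q := by positivity
  refine ⟨B + C + Q, by positivity, fun x => ?_⟩
  have key : ∀ s ∈ Icc t₀ T, ∀ t ∈ Icc t₀ T, s < t →
      |sInf (G.costs H c u₀ x s) - sInf (G.costs H c u₀ x t)| ≤ (B + C + Q) * (t - s) := by
    intro s hs t ht hst
    have hpos : 0 < t - s := sub_pos.2 hst
    have h0 := hB' x x s (t - s) (ht₀.le.trans hs.1) hpos (by linarith [ht.2]) (by simpa using hst)
    rw [add_sub_cancel] at h0
    have h1 : sInf (G.costs H c u₀ x s) ≤ sInf (G.costs H c u₀ x t) + (C + Q) * (t - s) := by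
      rcases le_total (t - s) δ₀ with h | h
      · have h2 := hC' x t ht (t - s) ⟨hpos.le, h⟩
        rw [sub_sub_cancel] at h2
        have h3 := mul_nonneg hQ0 hpos.le
        linarith
      · have h2 := hB₁' x s ⟨ht₀.le.trans hs.1, hs.2⟩
        have h3 := hM' x t ⟨ht₀.le.trans ht.1, ht.2⟩
        have h4 := mul_le_mul_of_nonneg_left hs.2 hB₁
        have h5 := mul_le_mul_of_nonneg_left ht.2 hM
        have h6 : B₁ * T + 1 + M * T ≤ Q * (t - s) := by
          rw [hQ, div_mul_eq_mul_div, le_div_iff₀ hδ₀]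
          exact mul_le_mul_of_nonneg_left h (by positivity)
        have h7 := mul_nonneg hC hpos.le
        linarith
    have h2 := mul_nonneg hB hpos.le
    have h3 := mul_nonneg (add_nonneg hC hQ0) hpos.le
    rw [abs_le]
    constructor <;> linarith
  intro s hs t ht
  rcases lt_trichotomy s t with h | rfl | h
  · rw [abs_sub_comm s t, abs_of_pos (sub_pos.2 h)]
    exact key s hs t ht h
  · simp
  · rw [abs_sub_comm, abs_of_pos (sub_pos.2 h)]
    exact key t ht s hs h

theorem exists_lipschitzOnWith_sInf_costs (hH : G.IsHamiltonian H) (hc : G.IsFluxLimiter H c)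
    (hu₀ : UniformContinuous u₀) {t₀ T : ℝ} (ht₀ : 0 < t₀) (hT : t₀ ≤ T) :
    ∃ K : ℝ≥0, LipschitzOnWith K (fun p : G.Pt × ℝ => sInf (G.costs H c u₀ p.1 p.2))
      (univ ×ˢ Icc t₀ T) := by
  obtain ⟨K₁, hK₁, h₁⟩ := exists_sInf_costs_lipschitz_space hH hc hu₀ ht₀ hT
  obtain ⟨K₂, hK₂, h₂⟩ := exists_sInf_costs_lipschitz_time hH hc hu₀ ht₀ hT
  -- The `+ 1` keeps the constant positive, so that the bound is `⊤` when the distance is `⊤`.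
  refine ⟨(K₁ + K₂ + 1).toNNReal, fun p hp q hq => ?_⟩
  have hKpos : 0 < K₁ + K₂ + 1 := by positivity
  rcases eq_or_ne (edist p q) ⊤ with htop | htop
  · rw [htop, ENNReal.mul_top (by simpa using hKpos)]
    exact le_top
  set d := (edist p q).toReal with hd
  have hd' : edist p q = ENNReal.ofReal d := (ENNReal.ofReal_toReal htop).symm
  have hd0 : 0 ≤ d := ENNReal.toReal_nonneg
  have hx : edist p.1 q.1 ≤ ENNReal.ofReal d := hd' ▸ le_max_left _ _
  have ht : |p.2 - q.2| ≤ d := by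
    have : edist p.2 q.2 ≤ ENNReal.ofReal d := hd' ▸ le_max_right _ _
    rwa [edist_dist, ENNReal.ofReal_le_ofReal_iff hd0, Real.dist_eq] at this
  have e1 := h₁ p.2 hp.2 p.1 q.1 d hd0 hx
  have e2 := h₂ q.1 p.2 hp.2 q.2 hq.2
  have e3 := mul_le_mul_of_nonneg_left ht hK₂
  rw [hd', ← ENNReal.ofReal, ← ENNReal.ofReal_mul hKpos.le, edist_dist, Real.dist_eq]
  refine ENNReal.ofReal_le_ofReal ((abs_sub_le _ (sInf (G.costs H c u₀ q.1 p.2)) _).trans ?_)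
  linarith

/-- The Lipschitz constant may blow up as time tends to 0. There the two-sided comparison with `u₀`
transfers its modulus; at later times the Lipschitz bound takes over. -/
theorem uniformContinuousOn_sInf_costs (hH : G.IsHamiltonian H) (hc : G.IsFluxLimiter H c)
    (hu₀ : UniformContinuous u₀) {T : ℝ} (hT : 0 < T) :
    UniformContinuousOn (fun p : G.Pt × ℝ => sInf (G.costs H c u₀ p.1 p.2))
      (univ ×ˢ Icc 0 T) := by
  rw [EMetric.uniformContinuousOn_iff]
  intro ε' hε'
  obtain ⟨ε, hε, hεε'⟩ : ∃ ε : ℝ, 0 < ε ∧ ENNReal.ofReal ε ≤ ε' := by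
    obtain ⟨p, hp, hp'⟩ := ENNReal.lt_iff_exists_nnreal_btwn.1 hε'
    exact ⟨p, by exact_mod_cast hp, by simpa using hp'.le⟩
  obtain ⟨δ, hδ, hu⟩ :=
    EMetric.uniformContinuous_iff.1 hu₀ (ENNReal.ofReal (ε / 4)) (by simpa using hε)
  obtain ⟨B, hB, hB'⟩ := exists_sInf_costs_le hH hc hu₀ hT
  obtain ⟨M, hM, hM'⟩ := exists_le_sInf_costs hH hc hu₀ hT (ε := ε / 8) (by positivity)
  set r := ε / (8 * (B + M + 1)) with hr
  have hrpos : 0 < r := by positivity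
  have hrε : (B + M) * r ≤ ε / 8 := by
    rw [hr, ← mul_div_assoc, div_le_div_iff₀ (by positivity) (by norm_num)]
    nlinarith
  have hsmall : ∀ x : G.Pt, ∀ t ∈ Icc 0 T, t ≤ r →
      |sInf (G.costs H c u₀ x t) - u₀ x| ≤ ε / 4 := by
    intro x t ht htr
    have h1 := hB' x t ht
    have h2 := hM' x t ht
    have h3 := mul_le_mul_of_nonneg_left htr hB
    have h4 := mul_le_mul_of_nonneg_left htr hM
    have h5 := mul_nonneg hB hrpos.le
    have h6 := mul_nonneg hM hrpos.le
    rw [abs_le]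
    constructor <;> linarith
  -- The horizon `T + r` guarantees `r / 2 ≤ T + r` even if `r` is large compared with `T`.
  obtain ⟨K, hK⟩ := exists_lipschitzOnWith_sInf_costs hH hc hu₀ (half_pos hrpos)
    (T := T + r) (by linarith)
  refine ⟨min δ (min (ENNReal.ofReal (r / 2)) (ENNReal.ofReal (ε / (K + 1)))),
    lt_min hδ (lt_min (by simpa using hrpos) (by simp only [ENNReal.ofReal_pos]; positivity)), ?_⟩
  rintro ⟨x, s⟩ hp ⟨y, t⟩ hq hpq
  have hs : s ∈ Icc 0 T := hp.2
  have ht : t ∈ Icc 0 T := hq.2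
  obtain ⟨h1, h2, h3⟩ := (lt_min_iff.trans (and_congr_right fun _ => lt_min_iff)).1 hpq
  refine lt_of_lt_of_le ?_ hεε'
  have hst : |s - t| < r / 2 := by
    have : edist s t < ENNReal.ofReal (r / 2) := (le_max_right _ _).trans_lt h2
    rwa [edist_dist, ENNReal.ofReal_lt_ofReal_iff (half_pos hrpos), Real.dist_eq] at this
  have hst' := abs_lt.1 hst
  -- Since `|s - t| < r / 2`, two times that are not both at most `r` are both at least `r / 2`.
  by_cases hcase : s ≤ r ∧ t ≤ r
  · have e0 := hu ((le_max_left _ _).trans_lt h1 : edist x y < δ)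
    rw [edist_dist, ENNReal.ofReal_lt_ofReal_iff (by positivity), Real.dist_eq] at e0
    have e1 := abs_le.1 (hsmall x s hs hcase.1)
    have e2 := abs_le.1 (hsmall y t ht hcase.2)
    have e3 := abs_lt.1 e0
    rw [edist_dist, ENNReal.ofReal_lt_ofReal_iff hε, Real.dist_eq, abs_lt]
    constructor <;> linarith [e1.1, e1.2, e2.1, e2.2, e3.1, e3.2]
  · have hlow : r / 2 ≤ s ∧ r / 2 ≤ t := by
      rw [not_and_or, not_le, not_le] at hcase
      rcases hcase with h | h <;> constructor <;> linarith [hst'.1, hst'.2]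
    refine (hK (x := (x, s)) ⟨mem_univ _, hlow.1, by linarith [hs.2]⟩ (y := (y, t))
      ⟨mem_univ _, hlow.2, by linarith [ht.2]⟩).trans_lt ?_
    refine (mul_le_mul_right h3.le _).trans_lt ?_
    rw [← ENNReal.ofReal_coe_nnreal, ← ENNReal.ofReal_mul K.coe_nonneg, ENNReal.ofReal_lt_ofReal_iff hε,
      ← mul_div_assoc, div_lt_iff₀ (by positivity)]
    linarith

end Regularity

end EmbeddedNetwork

end

/-! ### Transfer to the value function. -/

theorem mainTheorem11 {N : ℕ} {E : Type*} [Countable E] (G : EmbeddedNetwork N E)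
    (H : E → ℝ → ℝ → ℝ → ℝ) (hH : G.IsHamiltonian H)
    (c : EuclideanSpace ℝ (Fin N) → ℝ → ℝ) (hc : G.IsFluxLimiter H c)
    (u₀ : G.Pt → ℝ) (hu₀ : UniformContinuous u₀) :
    (∀ x : G.Pt, ∀ t : ℝ, 0 ≤ t →
      G.valueFunction H c u₀ x t ≠ ⊥ ∧ G.valueFunction H c u₀ x t ≠ ⊤) ∧
    (∀ T : ℝ, 0 < T →
      UniformContinuousOn (fun p : G.Pt × ℝ => (G.valueFunction H c u₀ p.1 p.2).toReal)
        (Set.univ ×ˢ Set.Icc 0 T)) ∧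
    ContinuousOn (fun p : G.Pt × ℝ => (G.valueFunction H c u₀ p.1 p.2).toReal)
      (Set.univ ×ˢ Set.Ici 0) ∧
    (∀ t₀ T : ℝ, 0 < t₀ → t₀ < T → ∃ K : NNReal,
      LipschitzOnWith K (fun p : G.Pt × ℝ => (G.valueFunction H c u₀ p.1 p.2).toReal)
        (Set.univ ×ˢ Set.Icc t₀ T)) := by
  have hval : ∀ x : G.Pt, ∀ t : ℝ, 0 ≤ t →
      G.valueFunction H c u₀ x t = ((sInf (G.costs H c u₀ x t) : ℝ) : EReal) := fun x t ht =>
    EmbeddedNetwork.valueFunction_eq_sInf hH hc ht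
      (EmbeddedNetwork.nonempty_costs hH hc u₀ ht x)
      (EmbeddedNetwork.bddBelow_costs hH hc hu₀ ht x)
  have hreal : ∀ p : G.Pt × ℝ, 0 ≤ p.2 →
      sInf (G.costs H c u₀ p.1 p.2) = (G.valueFunction H c u₀ p.1 p.2).toReal := fun p hp => by
    rw [hval p.1 p.2 hp, EReal.toReal_coe]
  have huc : ∀ T : ℝ, 0 < T →
      UniformContinuousOn (fun p : G.Pt × ℝ => (G.valueFunction H c u₀ p.1 p.2).toReal)
        (Set.univ ×ˢ Set.Icc 0 T) := fun T hT =>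
    (EmbeddedNetwork.uniformContinuousOn_sInf_costs hH hc hu₀ hT).congr
      fun p hp => hreal p hp.2.1
  refine ⟨fun x t ht => ?_, huc, fun p hp => ?_, fun t₀ T ht₀ hT => ?_⟩
  · rw [hval x t ht]
    exact ⟨EReal.coe_ne_bot _, EReal.coe_ne_top _⟩
  · have hp2 : 0 ≤ p.2 := hp.2
    have hmem : p ∈ (Set.univ : Set G.Pt) ×ˢ Set.Icc 0 (p.2 + 1) :=
      ⟨mem_univ _, hp2, by linarith⟩
    -- The strip up to time `p.2 + 1` is a neighbourhood of `p` within the whole domain, so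
    -- continuity on strips suffices.
    refine ((huc (p.2 + 1) (by linarith)).continuousOn p hmem).mono_of_mem_nhdsWithin ?_
    have hopen : (Prod.snd ⁻¹' Set.Iio (p.2 + 1) : Set (G.Pt × ℝ)) ∈ nhds p :=
      (isOpen_Iio.preimage continuous_snd).mem_nhds (by simp)
    filter_upwards [self_mem_nhdsWithin, mem_nhdsWithin_of_mem_nhds hopen] with q hq hq'
    exact ⟨mem_univ _, hq.2, le_of_lt hq'⟩
  · obtain ⟨K, hK⟩ := EmbeddedNetwork.exists_lipschitzOnWith_sInf_costs hH hc hu₀ ht₀ hT.le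
    refine ⟨K, fun p hp q hq => ?_⟩
    have hp0 : 0 ≤ p.2 := ht₀.le.trans hp.2.1
    have hq0 : 0 ≤ q.2 := ht₀.le.trans hq.2.1
    simp only [← hreal p hp0, ← hreal q hq0]
    exact hK hp hq
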